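/- **Setting.** A transmitter with $N_T$ antennas, a RIS with $N_I$ elements and a receiver with $N_R$ antennas form a multiport network with complex symmetric admittance matrix $\mathbf Y=(\mathbf Y_{ab})_{a,b\in\{T,I,R\}}$ whose real part is positive definite. The load admittance matrix $\mathbf Y_R$ is diagonal with positive real entries, and $Y_0>0$ is a reference admittance. If the RIS has real symmetric susceptance matrix $\mathbf B\in\mathbb R^{N_I\times N_I}$, the general physics-consistent channel is $$\mathbf H(\mathbf B)=(\mathbf Y_R+\mathbf Y_{RR})^{-1}\Big(-\mathbf Y_{RT}+\mathbf Y_{RI}\big(\mathrm i\mathbf B+\bar{\mathbf Y}_{II}\big)^{-1}\big(\mathbf Y_{IT}-\mathbf Y_{IR}(\mathbf Y_R+\mathbf Y_{RR})^{-1}\mathbf Y_{RT}\big)\Big),$$ $$\bar{\mathbf Y}_{II}=\mathbf Y_{II}-\mathbf Y_{IR}(\mathbf Y_{RR}+\mathbf Y_R)^{-1}\mathbf Y_{RI}.$$ Let $\mathcal S$ be the set of real symmetric $N_I\times N_I$ matrices, $\mathcal H_{\rm fully}=\{\mathbf H(\mathbf B):\mathbf B\in\mathcal S\}$, and $\mathcal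 H_{{\rm band},q}=\{\mathbf H(\mathbf B):\mathbf B\in\mathcal S,\ B_{ij}=0\text{ if }|i-j|>q\}$. For a graph $G$ on the RIS elements let $\mathcal H_G=\{\mathbf H(\mathbf B):\mathbf B\in\mathcal S,\ B_{ij}=0\text{ if }i\ne j\text{ are not adjacent in }G\}$. Put $\mathbf P=\mathrm{Re}(\bar{\mathbf Y}_{II})^{-1/2}$, $\bar{\mathbf B}=Y_0\mathbf P(\mathbf B+\mathrm{Im}\,\bar{\mathbf Y}_{II})\mathbf P$, $\bar{\boldsymbol\Theta}(\mathbf B)=(Y_0\mathbf I+\mathrm i\bar{\mathbf B})^{-1}(Y_0\mathbf I-\mathrm i\bar{\mathbf B})$, and $$\bar{\mathbf H}_{RI}=-\tfrac1{\sqrt2}(\mathbf Y_R+\mathbf Y_{RR})^{-1}\mathbf Y_{RI}\mathbf P,\qquad \bar{\mathbf H}_{IT}=-\tfrac1{\sqrt2}\mathbf P\big(\mathbf Y_{IT}-\mathbf Y_{IR}(\mathbf Y_R+\mathbf Y_{RR})^{-1}\mathbf Y_{RT}\big),$$ $$\bar{\mathbf H}_{RT}=-(\mathbf Y_R+\mathbf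 Y_{RR})^{-1}\mathbf Y_{RT}+\bar{\mathbf H}_{RI}\bar{\mathbf H}_{IT}.$$ For a complex $k\times N_I$ matrix $\mathbf L$ put $\mathbf U_{\mathbf L}(\mathbf B)=(\mathbf L\bar{\boldsymbol\Theta}(\mathbf B))^H$, $\mathcal U_{\mathbf L}=\{\mathbf U_{\mathbf L}(\mathbf B):\mathbf B\in\mathcal S\}$, and let $\mathcal N_{\mathbf L}$ be the set of $\mathbf U\in\mathbb C^{N_I\times k}$ for which the real $N_I\times 2k$ matrix $\mathbf P\,[\mathrm{Re}(\mathrm i\mathbf U+\mathrm i\mathbf L^H),\ \mathrm{Im}(\mathrm i\mathbf U+\mathrm i\mathbf L^H)]$ has a singular square submatrix. Let $$\mathcal N_R=\{\bar{\mathbf H}_{RT}+\mathbf U^H\bar{\mathbf H}_{IT}:\mathbf U\in\mathcal U_{\mathbf L}\cap\mathcal N_{\mathbf L}\},\ \mathbf L=\bar{\mathbf H}_{RI};\qquad \mathcal N_T=\{(\bar{\mathbf H}_{RT}^T+\mathbf U^H\bar{\mathbf H}_{RI}^T)^T:\mathbf U\in\mathcal U_{\mathbf L}\cap\mathcal N_{\mathbf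 L}\},\ \mathbf L=\bar{\mathbf H}_{IT}^T.$$ For a set $V$ of matrices, a set $S$ is called *low-dimensional in* $V$ if some real polynomial in the (real and imaginary parts of the) entries vanishes on $S\cap V$ but not identically on $V$. **Proposition.** Let $D=\min\{N_R,N_T\}$ and let $q=2\min\{D,N_I/2\}-1$ be a non-negative integer (that is, $N_R,N_T,N_I\ge1$). Then: 1. If $N_R\le N_T$, then $\mathcal H_{\rm fully}=\mathcal H_{{\rm band},q}\cup\mathcal N_R$. If $N_T\le N_R$, then $\mathcal H_{\rm fully}=\mathcal H_{{\rm band},q}\cup\mathcal N_T$. 2. For $\mathbf L=\bar{\mathbf H}_{RI}$ and for $\mathbf L=\bar{\mathbf H}_{IT}^T$, $\mathcal N_{\mathbf L}$ is low-dimensional in the space of all complex matrices of its size. If moreover any at most $N_I$ rows of $\mathbf L$ are linearly independent (for $k\le N_I$: $\mathbf L$ has full row rank), then $\{\mathbf B\in\mathcal S:\mathbf U_{\mathbf L}(\mathbf B)\in\mathcal N_{\mathbf L}\}$ is low-dimensional in $\mathcal S$. 3. $\{\mathbf B\in\mathcal S:\mathbf H(\mathbf B)\notin\mathcal H_{{\rm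 band},q}\}$ is low-dimensional in $\mathcal S$, hence of measure zero. 4. (MISO) If $N_R=1$, then for every tree $G$ on the RIS elements $\mathcal H_{\rm fully}=\mathcal H_G\cup\mathcal N_R$, and $\{\mathbf B\in\mathcal S:\mathbf H(\mathbf B)\notin\mathcal H_G\}$ is low-dimensional in $\mathcal S$. -/

import Mathlib

namespace RIS

open scoped MatrixOrder
open Matrix

/-- Entrywise real part of a complex matrix. -/
def rePart {m n : Type*} (A : Matrix m n ℂ) : Matrix m n ℝ := A.map Complex.re

/-- Entrywise imaginary part of a complex matrix. -/
def imPart {m n : Type*} (A : Matrix m n ℂ) : Matrix m n ℝ := A.map Complex.im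

/-- A real matrix seen as a complex one. -/
def toC {m n : Type*} (A : Matrix m n ℝ) : Matrix m n ℂ := A.map Complex.ofReal

/-- The wireless multiport network (`NT` transmit ports, `NI` RIS ports, `NR` receive ports), given
by its admittance matrix `Y` (partitioned in the order transmitter, RIS, receiver), the load
admittances `yR` of the receive antennas, and the reference admittance `y0`.  The network is
reciprocal (`Y` symmetric) and lossy (`Re Y` positive definite); load admittances are positive. -/
structure Network (NT NI NR : ℕ) where
  Y : Matrix (Fin NT ⊕ Fin NI ⊕ Fin NR) (Fin NT ⊕ Fin NI ⊕ Fin NR) ℂ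
  yR : Fin NR → ℝ
  y0 : ℝ
  symm : Y.IsSymm
  re_posDef : (rePart Y).PosDef
  yR_pos : ∀ i, 0 < yR i
  y0_pos : 0 < y0

namespace Network

variable {NT NI NR : ℕ} (net : Network NT NI NR)

/-! The blocks of the admittance matrix. -/

def YII : Matrix (Fin NI) (Fin NI) ℂ :=
  net.Y.submatrix (fun i => Sum.inr (Sum.inl i)) (fun j => Sum.inr (Sum.inl j))

def YIT : Matrix (Fin NI) (Fin NT) ℂ :=
  net.Y.submatrix (fun i => Sum.inr (Sum.inl i)) (fun j => Sum.inl j)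

def YIR : Matrix (Fin NI) (Fin NR) ℂ :=
  net.Y.submatrix (fun i => Sum.inr (Sum.inl i)) (fun j => Sum.inr (Sum.inr j))

def YRT : Matrix (Fin NR) (Fin NT) ℂ :=
  net.Y.submatrix (fun i => Sum.inr (Sum.inr i)) (fun j => Sum.inl j)

def YRI : Matrix (Fin NR) (Fin NI) ℂ :=
  net.Y.submatrix (fun i => Sum.inr (Sum.inr i)) (fun j => Sum.inr (Sum.inl j))

def YRR : Matrix (Fin NR) (Fin NR) ℂ :=
  net.Y.submatrix (fun i => Sum.inr (Sum.inr i)) (fun j => Sum.inr (Sum.inr j))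

/-- The load admittance matrix `Y_R`. -/
def loadY : Matrix (Fin NR) (Fin NR) ℂ := Matrix.diagonal fun i => (net.yR i : ℂ)

/-- The general physics-consistent model: the channel matrix (from transmit voltages to receive
voltages) when the lossless reciprocal reconfigurable network of the RIS has admittance matrix
`Y_I = i B`, where `B` is its susceptance matrix. -/
noncomputable def channel (B : Matrix (Fin NI) (Fin NI) ℝ) : Matrix (Fin NR) (Fin NT) ℂ :=
  (net.loadY + net.YRR)⁻¹ *
    (-net.YRT + net.YRI *
      (Complex.I • toC B + net.YII - net.YIR * (net.loadY + net.YRR)⁻¹ * net.YRI)⁻¹ *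
      (net.YIT - net.YIR * (net.loadY + net.YRR)⁻¹ * net.YRT))

/-- The set of channels reachable by an RIS whose susceptance matrix ranges over `𝓑`. -/
noncomputable def reachable (𝓑 : Set (Matrix (Fin NI) (Fin NI) ℝ)) :
    Set (Matrix (Fin NR) (Fin NT) ℂ) :=
  net.channel '' 𝓑

/-! The virtual quantities. -/

noncomputable def barYII : Matrix (Fin NI) (Fin NI) ℂ :=
  net.YII - net.YIR * (net.YRR + net.loadY)⁻¹ * net.YRI

/-- `Re(barYII)^(-1/2)`, the inverse of the positive definite square root. -/
noncomputable def invSqrt : Matrix (Fin NI) (Fin NI) ℝ := (CFC.sqrt (rePart net.barYII))⁻¹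

noncomputable def barB (B : Matrix (Fin NI) (Fin NI) ℝ) : Matrix (Fin NI) (Fin NI) ℝ :=
  net.y0 • (net.invSqrt * (B + imPart net.barYII) * net.invSqrt)

/-- The virtual scattering matrix. -/
noncomputable def barTheta (B : Matrix (Fin NI) (Fin NI) ℝ) : Matrix (Fin NI) (Fin NI) ℂ :=
  ((net.y0 : ℂ) • (1 : Matrix (Fin NI) (Fin NI) ℂ) + Complex.I • toC (net.barB B))⁻¹ *
    ((net.y0 : ℂ) • (1 : Matrix (Fin NI) (Fin NI) ℂ) - Complex.I • toC (net.barB B))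

noncomputable def barYRT : Matrix (Fin NR) (Fin NT) ℂ :=
  (2 * (net.y0 : ℂ)) • ((net.loadY + net.YRR)⁻¹ * net.YRT)

noncomputable def barYRI : Matrix (Fin NR) (Fin NI) ℂ :=
  ((Real.sqrt 2 : ℂ) * (net.y0 : ℂ)) • ((net.loadY + net.YRR)⁻¹ * net.YRI * toC net.invSqrt)

noncomputable def barYIT : Matrix (Fin NI) (Fin NT) ℂ :=
  ((Real.sqrt 2 : ℂ) * (net.y0 : ℂ)) •
    (toC net.invSqrt * (net.YIT - net.YIR * (net.loadY + net.YRR)⁻¹ * net.YRT))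

noncomputable def barHRT : Matrix (Fin NR) (Fin NT) ℂ :=
  -((1 / (2 * (net.y0 : ℂ))) •
    (net.barYRT - (1 / (2 * (net.y0 : ℂ))) • (net.barYRI * net.barYIT)))

noncomputable def barHRI : Matrix (Fin NR) (Fin NI) ℂ := -((1 / (2 * (net.y0 : ℂ))) • net.barYRI)

noncomputable def barHIT : Matrix (Fin NI) (Fin NT) ℂ := -((1 / (2 * (net.y0 : ℂ))) • net.barYIT)

/-! The exceptional set.  The constructions below take a link matrix `L`; it is `barHRI` when the
receiver has the fewer antennas and, by reciprocity, `barHITᵀ` when the transmitter has. -/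

/-- `U = (L Θ)ᴴ`, for the virtual scattering matrix `Θ` that belongs to `B`. -/
noncomputable def linkU {k : ℕ} (L : Matrix (Fin k) (Fin NI) ℂ) (B : Matrix (Fin NI) (Fin NI) ℝ) :
    Matrix (Fin NI) (Fin k) ℂ :=
  (L * net.barTheta B)ᴴ

/-- The real matrix `Re(barYII)^(-1/2) [Re(iU + iLᴴ), Im(iU + iLᴴ)]` of size `NI × 2k`. -/
noncomputable def barM {k : ℕ} (L : Matrix (Fin k) (Fin NI) ℂ) (U : Matrix (Fin NI) (Fin k) ℂ) :
    Matrix (Fin NI) (Fin k ⊕ Fin k) ℝ :=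
  net.invSqrt * Matrix.fromCols (rePart (Complex.I • U + Complex.I • Lᴴ))
    (imPart (Complex.I • U + Complex.I • Lᴴ))

end Network

/-- `M` has a singular square submatrix (of some size). -/
def HasSingularSubmatrix {m n : Type*} (M : Matrix m n ℝ) : Prop :=
  ∃ (k : ℕ) (e : Fin k ↪ m) (f : Fin k ↪ n), (M.submatrix e f).det = 0

/-- The real symmetric matrices: the susceptance matrices of a fully-connected RIS. -/
def fullySet (N : ℕ) : Set (Matrix (Fin N) (Fin N) ℝ) := {B | B.IsSymm}

/-- The susceptance matrices of a band-connected RIS of bandwidth `q`. -/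
def bandSet (N q : ℕ) : Set (Matrix (Fin N) (Fin N) ℝ) :=
  {B | B.IsSymm ∧ ∀ i j : Fin N, (q : ℤ) < |(j : ℤ) - (i : ℤ)| → B i j = 0}

/-- The susceptance matrices of an RIS with interconnection graph `G`. -/
def graphSet {N : ℕ} (G : SimpleGraph (Fin N)) : Set (Matrix (Fin N) (Fin N) ℝ) :=
  {B | B.IsSymm ∧ ∀ i j : Fin N, i ≠ j → ¬ G.Adj i j → B i j = 0}

namespace Network

variable {NT NI NR : ℕ} (net : Network NT NI NR)

/-- The matrices `U = (L Θ)ᴴ` that a fully-connected RIS attains. -/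
noncomputable def fullyU {k : ℕ} (L : Matrix (Fin k) (Fin NI) ℂ) :
    Set (Matrix (Fin NI) (Fin k) ℂ) :=
  net.linkU L '' fullySet NI

/-- The matrices `U` for which the derived real matrix has a singular submatrix. -/
def singularU {k : ℕ} (L : Matrix (Fin k) (Fin NI) ℂ) : Set (Matrix (Fin NI) (Fin k) ℂ) :=
  {U | HasSingularSubmatrix (net.barM L U)}

/-- The exceptional channels, seen from the receiver. -/
noncomputable def exceptionalR : Set (Matrix (Fin NR) (Fin NT) ℂ) :=
  (fun U : Matrix (Fin NI) (Fin NR) ℂ => net.barHRT + Uᴴ * net.barHIT) ''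
    (net.fullyU net.barHRI ∩ net.singularU net.barHRI)

/-- The exceptional channels, seen from the transmitter (the same with the transposed channel). -/
noncomputable def exceptionalT : Set (Matrix (Fin NR) (Fin NT) ℂ) :=
  (fun U : Matrix (Fin NI) (Fin NT) ℂ => (net.barHRTᵀ + Uᴴ * net.barHRIᵀ)ᵀ) ''
    (net.fullyU net.barHITᵀ ∩ net.singularU net.barHITᵀ)

end Network

/-- With respect to the real coordinates `c`, the part of `S` in `V` lies in a proper real algebraic
subset of `V`: a polynomial that is not identically zero on `V` vanishes on `V ∩ S`. -/
def IsLowDimIn {E ι : Type*} (c : E → ι → ℝ) (V S : Set E) : Prop :=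
  ∃ p : MvPolynomial ι ℝ, (∃ x ∈ V, MvPolynomial.eval (c x) p ≠ 0) ∧
    ∀ x ∈ V ∩ S, MvPolynomial.eval (c x) p = 0

/-- The entries of a real matrix as coordinates. -/
def realCoords {m n : Type*} (B : Matrix m n ℝ) : m × n → ℝ := fun ij => B ij.1 ij.2

/-- The real and imaginary parts of the entries of a complex matrix as coordinates. -/
def complexCoords {m n : Type*} (U : Matrix m n ℂ) : (m × n) ⊕ (m × n) → ℝ :=
  Sum.elim (fun ij => (U ij.1 ij.2).re) (fun ij => (U ij.1 ij.2).im)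

/-- Any at most `N` rows of the `k × N` matrix `L` are linearly independent (for `k ≤ N`: the matrix
has full row rank). -/
def MaximalRank {k N : ℕ} (L : Matrix (Fin k) (Fin N) ℂ) : Prop :=
  ∀ s : Finset (Fin k), s.card ≤ N → LinearIndependent ℂ (fun i : s => L (i : Fin k))

end RIS

/-! Write `A = barYIIᴴ`, `S = Re(barYII)^(1/2)` and `x = (A - iB)⁻¹ C` with `C = 2i S Lᴴ`. The
virtual scattering matrix is `2 S ((A - iB)⁻¹)ᴴ S - 1`, so `iU + iLᴴ = S x`, and the real matrix `M`
that defines the exceptional set is `[Re x, Im x]`. Since `(A - iB) x = C`, a symmetric `B'` with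
`B' M = B M` solves the same equation and gives the same link `L Θ`
(`Network.link_eq_of_mul_barM_eq`). The link of either side determines the channel, because `Θ` is
symmetric. It remains to find a sparse symmetric `B'` with `B' M = B M`.

Let `M` have `2k` columns and nonsingular square submatrices. For `2k` rows `T` and a further row
`j`, some left null vector `v` of `M` has support exactly `T ∪ {j}`. Adding multiples of `v vᵀ`
keeps `B M` and symmetry, and clears the entry `(i, j)` for a chosen `i ∈ T`
(`RowsInGeneralPosition.exists_clear_row`). Removing the elements one by one leaves a band or a tree
(`RowsInGeneralPosition.exists_supported`).

For genericity, the minors of `M` are rational in `B`, and the symmetric matrices form an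
irreducible variety, so each minor only needs one configuration where it is non-zero. A minor is a
determinant of rows of `Re((A - iB)⁻¹ Y)`, with columns of `Y` from `C` and `-iC`. If it vanished
identically, its first variation at a `B` where a smaller minor is non-zero would give `Im(gᵀ H z) =
0` for all real symmetric `H`, with non-zero vectors `g`, `z`. Then `z` is a real multiple of the
conjugate of `g`, or both are real up to a complex factor. Accretivity of `A - iB` excludes both
cases (`exists_det_rePart_resolvent_mul_ne_zero`). A rank-deficient `L` is factored through a matrix
of full row rank, so the statement about channels needs no rank hypothesis. -/

namespace RIS

open scoped MatrixOrder
open Matrix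

/-! ### Rational functions and irreducibility on a set with real coordinates. -/

section Regular

variable {E ι : Type*} {c : E → ι → ℝ} {V : Set E}

/-- On `V`, the function `F` is a quotient of polynomials in the coordinates `c`, with a
denominator that vanishes nowhere on `V`. -/
def IsRegular (c : E → ι → ℝ) (V : Set E) (F : E → ℝ) : Prop :=
  ∃ p q : MvPolynomial ι ℝ, ∀ x ∈ V,
    MvPolynomial.eval (c x) q ≠ 0 ∧ F x * MvPolynomial.eval (c x) q = MvPolynomial.eval (c x) p

/-- Two polynomials that are not identically zero on `V` have a common non-zero on `V`. -/
def IsIrreducibleIn (c : E → ι → ℝ) (V : Set E) : Prop :=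
  ∀ p q : MvPolynomial ι ℝ, (∃ x ∈ V, MvPolynomial.eval (c x) p ≠ 0) →
    (∃ x ∈ V, MvPolynomial.eval (c x) q ≠ 0) →
    ∃ x ∈ V, MvPolynomial.eval (c x) p ≠ 0 ∧ MvPolynomial.eval (c x) q ≠ 0

lemma IsRegular.const (a : ℝ) : IsRegular c V fun _ => a :=
  ⟨MvPolynomial.C a, 1, fun x _ => by simp⟩

lemma IsRegular.coord (i : ι) : IsRegular c V fun x => c x i :=
  ⟨MvPolynomial.X i, 1, fun x _ => by simp⟩

lemma IsRegular.add {F G : E → ℝ} (hF : IsRegular c V F) (hG : IsRegular c V G) :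
    IsRegular c V fun x => F x + G x := by
  obtain ⟨p, q, h⟩ := hF
  obtain ⟨p', q', h'⟩ := hG
  refine ⟨p * q' + p' * q, q * q', fun x hx => ?_⟩
  obtain ⟨h1, h2⟩ := h x hx
  obtain ⟨h3, h4⟩ := h' x hx
  simp only [map_mul, map_add]
  refine ⟨mul_ne_zero h1 h3, ?_⟩
  rw [← h2, ← h4]; ring

lemma IsRegular.mul {F G : E → ℝ} (hF : IsRegular c V F) (hG : IsRegular c V G) :
    IsRegular c V fun x => F x * G x := by
  obtain ⟨p, q, h⟩ := hF
  obtain ⟨p', q', h'⟩ := hG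
  refine ⟨p * p', q * q', fun x hx => ?_⟩
  obtain ⟨h1, h2⟩ := h x hx
  obtain ⟨h3, h4⟩ := h' x hx
  simp only [map_mul]
  refine ⟨mul_ne_zero h1 h3, ?_⟩
  rw [← h2, ← h4]; ring

lemma IsRegular.neg {F : E → ℝ} (hF : IsRegular c V F) : IsRegular c V fun x => -F x := by
  simpa using (IsRegular.const (-1)).mul hF

lemma IsRegular.sub {F G : E → ℝ} (hF : IsRegular c V F) (hG : IsRegular c V G) :
    IsRegular c V fun x => F x - G x := by
  simpa [sub_eq_add_neg] using hF.add hG.neg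

lemma IsRegular.inv {F : E → ℝ} (hF : IsRegular c V F) (h0 : ∀ x ∈ V, F x ≠ 0) :
    IsRegular c V fun x => (F x)⁻¹ := by
  obtain ⟨p, q, h⟩ := hF
  refine ⟨q, p, fun x hx => ?_⟩
  obtain ⟨h1, h2⟩ := h x hx
  have := h0 x hx
  rw [← h2]
  exact ⟨mul_ne_zero this h1, by field_simp⟩

lemma IsRegular.sum {κ : Type*} (s : Finset κ) {F : κ → E → ℝ}
    (hF : ∀ i ∈ s, IsRegular c V (F i)) : IsRegular c V fun x => ∑ i ∈ s, F i x := by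
  classical
  induction s using Finset.induction_on with
  | empty => simpa using IsRegular.const 0
  | insert a s ha ih =>
    simp only [Finset.sum_insert ha]
    exact (hF a (Finset.mem_insert_self a s)).add
      (ih fun i hi => hF i (Finset.mem_insert_of_mem hi))

lemma IsRegular.prod {κ : Type*} (s : Finset κ) {F : κ → E → ℝ}
    (hF : ∀ i ∈ s, IsRegular c V (F i)) : IsRegular c V fun x => ∏ i ∈ s, F i x := by
  classical
  induction s using Finset.induction_on with
  | empty => simpa using IsRegular.const 1
  | insert a s ha ih =>
    simp only [Finset.prod_insert ha]
    exact (hF a (Finset.mem_insert_self a s)).mul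
      (ih fun i hi => hF i (Finset.mem_insert_of_mem hi))

lemma IsRegular.det {κ : Type*} [Fintype κ] [DecidableEq κ] {A : E → Matrix κ κ ℝ}
    (hA : ∀ i j, IsRegular c V fun x => A x i j) : IsRegular c V fun x => (A x).det := by
  simp only [Matrix.det_apply']
  exact IsRegular.sum _ fun σ _ => (IsRegular.const _).mul (IsRegular.prod _ fun i _ => hA _ _)

/-- A complex function with regular real and imaginary parts. -/
def IsRegularC (c : E → ι → ℝ) (V : Set E) (F : E → ℂ) : Prop :=
  IsRegular c V (fun x => (F x).re) ∧ IsRegular c V fun x => (F x).im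

lemma IsRegularC.const (a : ℂ) : IsRegularC c V fun _ => a := ⟨.const _, .const _⟩

lemma IsRegular.ofReal {F : E → ℝ} (hF : IsRegular c V F) : IsRegularC c V fun x => (F x : ℂ) :=
  ⟨by simpa using hF, by simpa using IsRegular.const 0⟩

lemma IsRegularC.add {F G : E → ℂ} (hF : IsRegularC c V F) (hG : IsRegularC c V G) :
    IsRegularC c V fun x => F x + G x :=
  ⟨by simpa using hF.1.add hG.1, by simpa using hF.2.add hG.2⟩

lemma IsRegularC.mul {F G : E → ℂ} (hF : IsRegularC c V F) (hG : IsRegularC c V G) :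
    IsRegularC c V fun x => F x * G x :=
  ⟨by simpa using (hF.1.mul hG.1).sub (hF.2.mul hG.2),
    by simpa using (hF.1.mul hG.2).add (hF.2.mul hG.1)⟩

lemma IsRegularC.neg {F : E → ℂ} (hF : IsRegularC c V F) : IsRegularC c V fun x => -F x := by
  simpa using (IsRegularC.const (-1)).mul hF

lemma IsRegularC.sub {F G : E → ℂ} (hF : IsRegularC c V F) (hG : IsRegularC c V G) :
    IsRegularC c V fun x => F x - G x := by
  simpa [sub_eq_add_neg] using hF.add hG.neg

lemma IsRegularC.normSq {F : E → ℂ} (hF : IsRegularC c V F) :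
    IsRegular c V fun x => Complex.normSq (F x) := by
  simpa [Complex.normSq_apply] using (hF.1.mul hF.1).add (hF.2.mul hF.2)

lemma IsRegularC.inv {F : E → ℂ} (hF : IsRegularC c V F) (h0 : ∀ x ∈ V, F x ≠ 0) :
    IsRegularC c V fun x => (F x)⁻¹ := by
  have h := hF.normSq.inv fun x hx => by simpa using h0 x hx
  refine ⟨?_, ?_⟩
  · simpa [Complex.inv_re, div_eq_mul_inv] using hF.1.mul h
  · simpa [Complex.inv_im, div_eq_mul_inv] using hF.2.neg.mul h

lemma IsRegularC.sum {κ : Type*} (s : Finset κ) {F : κ → E → ℂ}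
    (hF : ∀ i ∈ s, IsRegularC c V (F i)) : IsRegularC c V fun x => ∑ i ∈ s, F i x :=
  ⟨by simpa using IsRegular.sum s fun i hi => (hF i hi).1,
    by simpa using IsRegular.sum s fun i hi => (hF i hi).2⟩

lemma IsRegularC.prod {κ : Type*} (s : Finset κ) {F : κ → E → ℂ}
    (hF : ∀ i ∈ s, IsRegularC c V (F i)) : IsRegularC c V fun x => ∏ i ∈ s, F i x := by
  classical
  induction s using Finset.induction_on with
  | empty => simpa using IsRegularC.const 1
  | insert a s ha ih =>
    simp only [Finset.prod_insert ha]
    exact (hF a (Finset.mem_insert_self a s)).mul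
      (ih fun i hi => hF i (Finset.mem_insert_of_mem hi))

lemma IsRegularC.det {κ : Type*} [Fintype κ] [DecidableEq κ] {A : E → Matrix κ κ ℂ}
    (hA : ∀ i j, IsRegularC c V fun x => A x i j) : IsRegularC c V fun x => (A x).det := by
  simp only [Matrix.det_apply']
  exact IsRegularC.sum _ fun σ _ =>
    (IsRegularC.const _).mul (IsRegularC.prod _ fun i _ => hA _ _)

lemma IsRegularC.inv_apply {κ : Type*} [Fintype κ] [DecidableEq κ] {A : E → Matrix κ κ ℂ}
    (hA : ∀ i j, IsRegularC c V fun x => A x i j) (h0 : ∀ x ∈ V, (A x).det ≠ 0) (i j : κ) :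
    IsRegularC c V fun x => (A x)⁻¹ i j := by
  simp only [Matrix.inv_def, Matrix.smul_apply, Ring.inverse_eq_inv', smul_eq_mul,
    Matrix.adjugate_apply]
  refine ((IsRegularC.det hA).inv h0).mul (IsRegularC.det fun a b => ?_)
  by_cases h : a = j
  · subst h
    simpa using IsRegularC.const _
  · simpa [Matrix.updateRow_apply, h] using hA a b

lemma IsRegularC.mul_apply {l κ m : Type*} [Fintype κ] {A : E → Matrix l κ ℂ}
    {B : E → Matrix κ m ℂ} (hA : ∀ i j, IsRegularC c V fun x => A x i j)
    (hB : ∀ i j, IsRegularC c V fun x => B x i j) (i : l) (j : m) :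
    IsRegularC c V fun x => (A x * B x) i j := by
  simp only [Matrix.mul_apply]
  exact IsRegularC.sum _ fun k _ => (hA i k).mul (hB k j)

lemma IsRegular.isLowDimIn {F : E → ℝ} (hF : IsRegular c V F) (h : ∃ x ∈ V, F x ≠ 0) :
    IsLowDimIn c V {x | F x = 0} := by
  obtain ⟨p, q, hpq⟩ := hF
  obtain ⟨x, hx, hFx⟩ := h
  refine ⟨p, ⟨x, hx, ?_⟩, fun y hy => ?_⟩
  · rw [← (hpq x hx).2]
    exact mul_ne_zero hFx (hpq x hx).1
  · rw [← (hpq y hy.1).2, show F y = 0 from hy.2, zero_mul]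

lemma IsIrreducibleIn.exists_ne_zero (hV : IsIrreducibleIn c V) {F G : E → ℝ}
    (hF : IsRegular c V F) (hG : IsRegular c V G) (hF0 : ∃ x ∈ V, F x ≠ 0)
    (hG0 : ∃ x ∈ V, G x ≠ 0) : ∃ x ∈ V, F x ≠ 0 ∧ G x ≠ 0 := by
  obtain ⟨p, hp, hpF⟩ := hF.isLowDimIn hF0
  obtain ⟨q, hq, hqG⟩ := hG.isLowDimIn hG0
  obtain ⟨x, hx, h1, h2⟩ := hV p q hp hq
  exact ⟨x, hx, fun h => h1 (hpF x ⟨hx, h⟩), fun h => h2 (hqG x ⟨hx, h⟩)⟩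

lemma IsLowDimIn.mono {S T : Set E} (h : IsLowDimIn c V T) (hST : ∀ x ∈ V, x ∈ S → x ∈ T) :
    IsLowDimIn c V S := by
  obtain ⟨p, hp, hpT⟩ := h
  exact ⟨p, hp, fun x hx => hpT x ⟨hx.1, hST x hx.1 hx.2⟩⟩

lemma IsLowDimIn.empty (hV : V.Nonempty) : IsLowDimIn c V ∅ := by
  obtain ⟨x, hx⟩ := hV
  exact ⟨1, ⟨x, hx, by simp⟩, fun y hy => hy.2.elim⟩

/-- The product of the defining polynomials vanishes on the union; irreducibility keeps it from
vanishing on all of `V`. -/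
lemma IsIrreducibleIn.isLowDimIn_iUnion (hV : IsIrreducibleIn c V) (hV0 : V.Nonempty)
    {κ : Type*} [Finite κ] {S : κ → Set E} (hS : ∀ i, IsLowDimIn c V (S i)) :
    IsLowDimIn c V (⋃ i, S i) := by
  classical
  cases nonempty_fintype κ
  choose p hp hpS using hS
  have key : ∀ s : Finset κ, ∃ x ∈ V, MvPolynomial.eval (c x) (∏ i ∈ s, p i) ≠ 0 := by
    intro s
    induction s using Finset.induction_on with
    | empty => obtain ⟨x, hx⟩ := hV0; exact ⟨x, hx, by simp⟩
    | insert a s ha ih =>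
      obtain ⟨x, hx, h1, h2⟩ := hV _ _ (hp a) ih
      exact ⟨x, hx, by rw [Finset.prod_insert ha, map_mul]; exact mul_ne_zero h1 h2⟩
  refine ⟨∏ i, p i, key _, fun x hx => ?_⟩
  obtain ⟨i, hi⟩ := Set.mem_iUnion.1 hx.2
  rw [map_prod]
  exact Finset.prod_eq_zero (Finset.mem_univ i) (hpS i x ⟨hx.1, hi⟩)

/-- A set parametrized polynomially by an affine space is irreducible. -/
lemma IsIrreducibleIn.of_param {κ : Type*} (φ : ι → MvPolynomial κ ℝ)
    (h1 : ∀ y : κ → ℝ, ∃ x ∈ V, ∀ i, c x i = MvPolynomial.eval y (φ i))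
    (h2 : ∀ x ∈ V, ∃ y : κ → ℝ, ∀ i, c x i = MvPolynomial.eval y (φ i)) :
    IsIrreducibleIn c V := by
  have ev : ∀ (y : κ → ℝ) (x : E), (∀ i, c x i = MvPolynomial.eval y (φ i)) →
      ∀ p, MvPolynomial.eval (c x) p = MvPolynomial.eval y (MvPolynomial.bind₁ φ p) := by
    intro y x h p
    rw [show c x = fun i => MvPolynomial.eval y (φ i) from funext h]
    simpa [MvPolynomial.eval₂Hom_eq_zero] using
      (MvPolynomial.eval₂Hom_bind₁ (RingHom.id ℝ) y φ p).symm
  have nz : ∀ p, (∃ x ∈ V, MvPolynomial.eval (c x) p ≠ 0) → MvPolynomial.bind₁ φ p ≠ 0 := by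
    rintro p ⟨x, hx, hp⟩ h
    obtain ⟨y, hy⟩ := h2 x hx
    rw [ev y x hy, h, map_zero] at hp
    exact hp rfl
  intro p q hp hq
  -- The pulled-back polynomials live in a domain over an infinite field, so their product is
  -- non-zero at some real parameter.
  have hpq := mul_ne_zero (nz p hp) (nz q hq)
  obtain ⟨y, hy⟩ : ∃ y, MvPolynomial.eval y (MvPolynomial.bind₁ φ p * MvPolynomial.bind₁ φ q) ≠ 0 := by
    by_contra! h
    exact hpq (MvPolynomial.funext fun y => by rw [h y, map_zero])
  obtain ⟨x, hx, hxy⟩ := h1 y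
  rw [map_mul, ← ev y x hxy, ← ev y x hxy] at hy
  exact ⟨x, hx, left_ne_zero_of_mul hy, right_ne_zero_of_mul hy⟩

end Regular

lemma isIrreducibleIn_fullySet (N : ℕ) : IsIrreducibleIn realCoords (fullySet N) := by
  refine IsIrreducibleIn.of_param
    (fun ij : Fin N × Fin N => MvPolynomial.X (ij.1, ij.2) + MvPolynomial.X (ij.2, ij.1))
    (fun y => ⟨Matrix.of fun i j => y (i, j) + y (j, i), ?_, fun ij => ?_⟩)
    (fun B hB => ⟨fun ij => B ij.1 ij.2 / 2, fun ij => ?_⟩)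
  · exact Matrix.IsSymm.ext fun i j => by simp [add_comm]
  · simp [realCoords]
  · have := hB.apply ij.1 ij.2
    simp [realCoords, this]

lemma isIrreducibleIn_complexCoords (m n : Type*) :
    IsIrreducibleIn (complexCoords (m := m) (n := n)) Set.univ := by
  refine IsIrreducibleIn.of_param MvPolynomial.X
    (fun y => ⟨Matrix.of fun i j => ⟨y (.inl (i, j)), y (.inr (i, j))⟩, trivial, ?_⟩)
    (fun U _ => ⟨complexCoords U, fun i => by simp⟩)
  rintro (ij | ij) <;> simp [complexCoords]

lemma fullySet_nonempty (N : ℕ) : (fullySet N).Nonempty := ⟨0, Matrix.isSymm_zero⟩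

/-- If every minor is the zero set of a function that is generically non-zero, then having a
singular submatrix is exceptional. -/
lemma isLowDimIn_hasSingularSubmatrix {E ι m n : Type*} [Fintype m] [Fintype n]
    {c : E → ι → ℝ} {V : Set E} (hV : IsIrreducibleIn c V) (hV0 : V.Nonempty)
    {M : E → Matrix m n ℝ} (hM : ∀ i j, IsRegular c V fun x => M x i j)
    (h : ∀ (k : ℕ) (e : Fin k ↪ m) (f : Fin k ↪ n), ∃ x ∈ V, ((M x).submatrix e f).det ≠ 0) :
    IsLowDimIn c V {x | HasSingularSubmatrix (M x)} := by
  classical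
  -- A minor has at most `card m` rows; bounding its size makes the union finite.
  let κ := Σ k : Fin (Fintype.card m + 1), (Fin k ↪ m) × (Fin k ↪ n)
  refine (hV.isLowDimIn_iUnion hV0 (κ := κ)
    (S := fun a => {x | ((M x).submatrix a.2.1 a.2.2).det = 0}) fun a => ?_).mono ?_
  · exact (IsRegular.det fun i j => hM _ _).isLowDimIn (h _ _ _)
  · rintro x - ⟨k, e, f, hk⟩
    have : k < Fintype.card m + 1 := by
      have := Fintype.card_le_of_embedding e
      simp at this
      omega
    exact Set.mem_iUnion.2 ⟨⟨⟨k, this⟩, e, f⟩, hk⟩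

/-! ### Complex symmetric matrices with positive definite real part. -/

section Accretive

variable {n : Type*} [Fintype n]

/-- A complex symmetric matrix with positive definite real part is strictly accretive. -/
lemma re_star_dotProduct_mulVec_pos {A : Matrix n n ℂ} (hA : A.IsSymm)
    (hR : (rePart A).PosDef) {x : n → ℂ} (hx : x ≠ 0) : 0 < (star x ⬝ᵥ A *ᵥ x).re := by
  have expand : (star x ⬝ᵥ A *ᵥ x).re =
      ((fun i => (x i).re) ⬝ᵥ rePart A *ᵥ fun i => (x i).re) +
      ((fun i => (x i).im) ⬝ᵥ rePart A *ᵥ fun i => (x i).im) +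
      (∑ i, ∑ j, (A i j).im * ((x i).im * (x j).re) -
        ∑ i, ∑ j, (A i j).im * ((x i).re * (x j).im)) := by
    simp only [dotProduct, mulVec, rePart, Matrix.map_apply, Finset.mul_sum,
      Complex.re_sum, ← Finset.sum_add_distrib, ← Finset.sum_sub_distrib]
    refine Finset.sum_congr rfl fun i _ => Finset.sum_congr rfl fun j _ => ?_
    simp
    ring
  -- The imaginary part of `A` is real symmetric, hence Hermitian: its quadratic form is real and
  -- contributes nothing to the real part of the form of `A`.
  have cancel : ∑ i, ∑ j, (A i j).im * ((x i).im * (x j).re) =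
      ∑ i, ∑ j, (A i j).im * ((x i).re * (x j).im) := by
    rw [Finset.sum_comm]
    refine Finset.sum_congr rfl fun i _ => Finset.sum_congr rfl fun j _ => ?_
    rw [hA.apply]
    ring
  rw [expand, cancel, sub_self, add_zero]
  have nonneg : ∀ a : n → ℝ, 0 ≤ a ⬝ᵥ rePart A *ᵥ a := fun a => by
    simpa using hR.posSemidef.dotProduct_mulVec_nonneg a
  have pos : ∀ a : n → ℝ, a ≠ 0 → 0 < a ⬝ᵥ rePart A *ᵥ a := fun a ha => by
    simpa using hR.dotProduct_mulVec_pos ha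
  by_cases h : (fun i => (x i).re) = 0
  · refine add_pos_of_nonneg_of_pos (nonneg _) (pos _ fun h' => hx ?_)
    funext i
    exact Complex.ext (congrFun h i) (congrFun h' i)
  · exact add_pos_of_pos_of_nonneg (pos _ h) (nonneg _)

variable [DecidableEq n]

lemma det_ne_zero_of_rePart_posDef {A : Matrix n n ℂ} (hA : A.IsSymm)
    (hR : (rePart A).PosDef) : A.det ≠ 0 := by
  intro h
  obtain ⟨x, hx, hAx⟩ := Matrix.exists_mulVec_eq_zero_iff.2 h
  have := re_star_dotProduct_mulVec_pos hA hR hx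
  simp [hAx] at this

omit [Fintype n] [DecidableEq n] in
lemma isSymm_sub_I_smul {A : Matrix n n ℂ} (hA : A.IsSymm) {B : Matrix n n ℝ} (hB : B.IsSymm) :
    (A - Complex.I • toC B).IsSymm := by
  refine hA.sub (Matrix.IsSymm.smul ?_ _)
  exact Matrix.IsSymm.ext fun i j => by simp [toC, hB.apply]

omit [Fintype n] [DecidableEq n] in
lemma rePart_sub_I_smul (A : Matrix n n ℂ) (B : Matrix n n ℝ) :
    rePart (A - Complex.I • toC B) = rePart A := by
  ext i j
  simp [rePart, toC]

lemma det_sub_I_smul_ne_zero {A : Matrix n n ℂ} (hA : A.IsSymm) (hR : (rePart A).PosDef)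
    {B : Matrix n n ℝ} (hB : B.IsSymm) : (A - Complex.I • toC B).det ≠ 0 :=
  det_ne_zero_of_rePart_posDef (isSymm_sub_I_smul hA hB) (by rwa [rePart_sub_I_smul])

end Accretive

/-! ### Factoring out the rank deficiency of a wide matrix. -/

/-- Rows of a wide matrix lie in the row space of a matrix of the same size and full row rank. -/
lemma exists_linearIndependent_rows {K : Type*} [Field K] {N : ℕ} :
    ∀ {k : ℕ}, k ≤ N → ∀ L : Fin k → Fin N → K,
      ∃ L' : Fin k → Fin N → K, LinearIndependent K L' ∧
        ∀ i, L i ∈ Submodule.span K (Set.range L')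
  | 0, _, L => ⟨L, linearIndependent_empty_type, fun i => i.elim0⟩
  | k + 1, hk, L => by
    obtain ⟨L', hL', hspan⟩ := exists_linearIndependent_rows (Nat.le_of_succ_le hk) (Fin.tail L)
    -- If the new row is already in the span, any vector outside it serves; one exists because `k <
    -- N`.
    have key : ∃ v, v ∉ Submodule.span K (Set.range L') ∧
        L 0 ∈ Submodule.span K (Set.range (Fin.cons v L' : Fin (k + 1) → Fin N → K)) := by
      by_cases h : L 0 ∈ Submodule.span K (Set.range L')
      · have : Submodule.span K (Set.range L') ≠ ⊤ := by
          intro htop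
          have := finrank_span_eq_card hL'
          rw [htop, finrank_top] at this
          simp at this
          omega
        obtain ⟨v, hv⟩ := SetLike.exists_not_mem_of_ne_top _ this rfl
        refine ⟨v, hv, Submodule.span_mono ?_ h⟩
        rw [Fin.range_cons]
        exact Set.subset_insert _ _
      · exact ⟨L 0, h, Submodule.subset_span ⟨0, rfl⟩⟩
    obtain ⟨v, hv, h0⟩ := key
    refine ⟨Fin.cons v L', linearIndependent_finCons.2 ⟨hL', hv⟩, fun i => ?_⟩
    refine Fin.cases h0 (fun j => Submodule.span_mono ?_ (hspan j)) i
    rw [Fin.range_cons]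
    exact Set.subset_insert _ _

/-- A wide matrix is a square matrix times a matrix of full row rank. -/
lemma exists_eq_mul_linearIndependent_rows {K : Type*} [Field K] {k N : ℕ} (hk : k ≤ N)
    (L : Matrix (Fin k) (Fin N) K) :
    ∃ (F : Matrix (Fin k) (Fin k) K) (L' : Matrix (Fin k) (Fin N) K),
      LinearIndependent K (fun i => L' i) ∧ L = F * L' := by
  obtain ⟨L', hL', hspan⟩ := exists_linearIndependent_rows hk L
  simp only [Submodule.mem_span_range_iff_exists_fun] at hspan
  choose F hF using hspan
  refine ⟨Matrix.of F, Matrix.of L', hL', ?_⟩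
  ext i j
  rw [← hF i, Finset.sum_apply]
  simp [Matrix.mul_apply]

lemma eq_zero_of_vecMul_eq_zero {K : Type*} [Field K] {k N : ℕ}
    {L : Matrix (Fin k) (Fin N) K} (hL : LinearIndependent K fun i => L i) {α : Fin k → K}
    (h : α ᵥ* L = 0) : α = 0 := by
  have h1 := Fintype.linearIndependent_iff.1 hL
  funext i
  refine h1 α ?_ i
  rw [← h]
  ext j
  simp [Matrix.vecMul, dotProduct]

/-! ### First variation of a singular matrix. -/

section Limit

variable {𝕜 : Type*} [RCLike 𝕜] {s : ℕ}

/-- First-order condition for a curve of singular matrices. -/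
lemma adjugate_mul_mul_adjugate_eq_zero {M D : ℝ → Matrix (Fin s) (Fin s) 𝕜}
    (hMc : ContinuousAt M 0) (hDc : ContinuousAt D 0) (hM : ∀ t, M t = M 0 + t • D t)
    (hdet : ∀ t, (M t).det = 0) : (M 0).adjugate * D 0 * (M 0).adjugate = 0 := by
  -- In `adj(M 0) * M t * adj(M t) = 0` the term with `M 0` drops out, as `M 0` is singular too.
  -- This leaves `t` times the claim, and `t → 0` follows.
  have h1 : ∀ t ≠ 0, (M 0).adjugate * D t * (M t).adjugate = 0 := by
    intro t ht
    have h : (M 0).adjugate * M t * (M t).adjugate = 0 := by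
      rw [mul_assoc, mul_adjugate, hdet]; simp
    rw [congrArg (fun X => (M 0).adjugate * X * (M t).adjugate) (hM t), mul_add, adjugate_mul, hdet, zero_smul, zero_add, mul_smul_comm, smul_mul_assoc] at h
    exact (smul_eq_zero.1 h).resolve_left ht
  have hc : ContinuousAt (fun t => (M 0).adjugate * D t * (M t).adjugate) 0 := by
    have : ContinuousAt (fun t => (M t).adjugate) 0 :=
      (continuous_id.matrix_adjugate.continuousAt (x := M 0)).comp hMc
    exact (continuousAt_const.mul hDc).mul this
  have hz : Filter.Tendsto (fun t => (M 0).adjugate * D t * (M t).adjugate)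
      (nhdsWithin 0 {0}ᶜ) (nhds 0) :=
    tendsto_const_nhds.congr' (by
      filter_upwards [self_mem_nhdsWithin] with t ht using (h1 t ht).symm)
  exact tendsto_nhds_unique (hc.tendsto.mono_left nhdsWithin_le_nhds) hz

end Limit

/-! ### The resolvent and generic non-vanishing of its minors. -/

section Resolvent

variable {N : ℕ} {A : Matrix (Fin N) (Fin N) ℂ}

/-- The resolvent `(A - iB)⁻¹`. -/
noncomputable def resolvent (A : Matrix (Fin N) (Fin N) ℂ) (B : Matrix (Fin N) (Fin N) ℝ) :
    Matrix (Fin N) (Fin N) ℂ :=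
  (A - Complex.I • toC B)⁻¹

lemma resolvent_mul_self (hA : A.IsSymm) (hR : (rePart A).PosDef)
    {B : Matrix (Fin N) (Fin N) ℝ} (hB : B.IsSymm) :
    resolvent A B * (A - Complex.I • toC B) = 1 :=
  Matrix.nonsing_inv_mul _ (Ne.isUnit (det_sub_I_smul_ne_zero hA hR hB))

lemma self_mul_resolvent (hA : A.IsSymm) (hR : (rePart A).PosDef)
    {B : Matrix (Fin N) (Fin N) ℝ} (hB : B.IsSymm) :
    (A - Complex.I • toC B) * resolvent A B = 1 :=
  Matrix.mul_nonsing_inv _ (Ne.isUnit (det_sub_I_smul_ne_zero hA hR hB))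

lemma isRegularC_resolvent (hA : A.IsSymm) (hR : (rePart A).PosDef) (i j : Fin N) :
    IsRegularC realCoords (fullySet N) fun B => resolvent A B i j := by
  refine IsRegularC.inv_apply (fun i j => ?_) (fun B hB => det_sub_I_smul_ne_zero hA hR hB) i j
  simp only [Matrix.sub_apply, Matrix.smul_apply, smul_eq_mul]
  exact (IsRegularC.const _).sub ((IsRegularC.const _).mul (IsRegular.coord (i, j)).ofReal)

lemma isRegularC_resolvent_mul (hA : A.IsSymm) (hR : (rePart A).PosDef) {κ : Type*}
    (Y : Matrix (Fin N) κ ℂ) (i : Fin N) (j : κ) :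
    IsRegularC realCoords (fullySet N) fun B => (resolvent A B * Y) i j :=
  IsRegularC.mul_apply (isRegularC_resolvent hA hR) (fun a b => .const (Y a b)) i j

/-- The second resolvent identity, exact in `t`; it supplies the difference quotient of the
resolvent along `H`. -/
lemma resolvent_add_smul (hA : A.IsSymm) (hR : (rePart A).PosDef)
    {B H : Matrix (Fin N) (Fin N) ℝ} (hB : B.IsSymm) (hH : H.IsSymm) (t : ℝ) :
    resolvent A (B + t • H) = resolvent A B +
      t • (resolvent A B * (Complex.I • toC H) * resolvent A (B + t • H)) := by
  have hBt : (B + t • H).IsSymm := hB.add (hH.smul t)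
  have h1 := resolvent_mul_self hA hR hB
  have h2 := self_mul_resolvent hA hR hBt
  have h3 : t • (Complex.I • toC H) =
      (A - Complex.I • toC B) - (A - Complex.I • toC (B + t • H)) := by
    ext i j
    simp [toC]
    ring
  rw [← smul_mul_assoc, ← mul_smul_comm, h3, mul_sub, h1, sub_mul, mul_assoc, h2, one_mul, mul_one]
  abel

lemma continuousAt_resolvent_add_smul (hA : A.IsSymm) (hR : (rePart A).PosDef)
    {B H : Matrix (Fin N) (Fin N) ℝ} (hB : B.IsSymm) :
    ContinuousAt (fun t : ℝ => resolvent A (B + t • H)) 0 := by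
  have h : ContinuousAt (fun t : ℝ => A - Complex.I • toC (B + t • H)) 0 := by
    refine Continuous.continuousAt ?_
    have h : Continuous fun t : ℝ => toC (B + t • H) :=
      Continuous.matrix_map (by fun_prop) Complex.continuous_ofReal
    exact continuous_const.sub (h.const_smul Complex.I)
  refine ContinuousAt.comp (g := Inv.inv) ?_ h
  refine continuousAt_matrix_inv _ ?_
  simp only [zero_smul, add_zero, Ring.inverse_eq_inv']
  exact continuousAt_inv₀ (det_sub_I_smul_ne_zero hA hR hB)

/-- Testing `gᵀ H z` on these elementary symmetric directions turns a condition for all symmetric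
`H` into conditions on the symmetric product of `g` and `z`. -/
lemma dotProduct_single_add_single_mulVec (g z : Fin N → ℂ) (j l : Fin N) :
    g ⬝ᵥ toC (Matrix.single j l 1 + Matrix.single l j 1 : Matrix (Fin N) (Fin N) ℝ) *ᵥ z =
      g j * z l + g l * z j := by
  have : toC (Matrix.single j l 1 + Matrix.single l j 1 : Matrix (Fin N) (Fin N) ℝ) =
      Matrix.single j l 1 + Matrix.single l j 1 := by
    ext a b
    simp only [toC, Matrix.map_apply, Matrix.add_apply, Matrix.single_apply]
    split_ifs <;> simp
  rw [this, Matrix.add_mulVec, dotProduct_add, Matrix.single_mulVec, Matrix.single_mulVec]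
  change g ⬝ᵥ Pi.single j _ + g ⬝ᵥ Pi.single l _ = _
  simp

lemma isSymm_single_add_single (j l : Fin N) :
    (Matrix.single j l 1 + Matrix.single l j 1 : Matrix (Fin N) (Fin N) ℝ).IsSymm := by
  rw [Matrix.IsSymm, Matrix.transpose_add, Matrix.transpose_single, Matrix.transpose_single,
    add_comm]

/-- Over a field of characteristic zero the symmetric product of non-zero vectors is non-zero. -/
lemma eq_zero_or_eq_zero_of_symm_mul {g z : Fin N → ℂ}
    (h : ∀ j l, g j * z l + g l * z j = 0) : g = 0 ∨ z = 0 := by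
  by_contra! hc
  obtain ⟨j, hj⟩ := Function.ne_iff.1 hc.1
  have hj : g j ≠ 0 := hj
  have hzj : z j = 0 := by
    have := h j j
    rw [← two_mul] at this
    simpa [hj] using this
  refine hc.2 (funext fun l => ?_)
  have := h j l
  rw [hzj, mul_zero, add_zero] at this
  exact (mul_eq_zero.1 this).resolve_left hj

/-- If a product of two complex linear forms is real, then either the forms are conjugate up to a
real factor, or both are real up to a complex factor. -/
lemma conj_or_real_of_symm_mul_im {g z : Fin N → ℂ} (hg : g ≠ 0)
    (h : ∀ j l, (g j * z l + g l * z j).im = 0) :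
    (∃ ρ : ℝ, ∀ l, z l = ρ * star (g l)) ∨
      ∃ (ω : ℂ) (g' z' : Fin N → ℝ), ω ≠ 0 ∧ (∀ l, g l = ω * g' l) ∧ ∀ l, z l = z' l / ω := by
  obtain ⟨j, hj⟩ := Function.ne_iff.1 hg
  have hj : g j ≠ 0 := hj
  -- Rescaling by `g j` and its inverse preserves the products and normalizes `a j = 1`.
  set a : Fin N → ℂ := fun l => g l / g j with ha
  set b : Fin N → ℂ := fun l => z l * g j with hb
  have hab : ∀ p l, (a p * b l + a l * b p).im = 0 := by
    intro p l
    rw [← h p l]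
    congr 1
    simp only [ha, hb]
    field_simp
  have haj : a j = 1 := div_self hj
  have hbj : (b j).im = 0 := by
    have := hab j j
    rw [haj] at this
    simpa using this
  have hbl : ∀ l, (b l).im = -((b j).re * (a l).im) := by
    intro l
    have := hab j l
    rw [haj] at this
    simp [hbj] at this
    linarith
  -- A symmetric product of two real vectors vanishes, so one of them is zero: `Im a = 0` is the
  -- real case, and `Re b = b j * Re a` the conjugate case.
  have hd : ∀ p l, (a p).im * ((b l).re - (b j).re * (a l).re) +
      (a l).im * ((b p).re - (b j).re * (a p).re) = 0 := by
    intro p l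
    have := hab p l
    simp only [Complex.add_im, Complex.mul_im, hbl l, hbl p] at this
    linarith
  by_cases him : ∀ p, (a p).im = 0
  · right
    refine ⟨g j, fun l => (a l).re, fun l => (b l).re, hj, fun l => ?_, fun l => ?_⟩
    · rw [show (((a l).re : ℝ) : ℂ) = a l from Complex.ext rfl (by simp [him l])]
      simp only [ha]
      field_simp
    · rw [show (((b l).re : ℝ) : ℂ) = b l from Complex.ext rfl (by simp [hbl l, him l])]
      simp only [hb]
      field_simp
  · left
    push Not at him
    obtain ⟨p, hp⟩ := him
    have hdp : (b p).re - (b j).re * (a p).re = 0 := by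
      have := hd p p
      rw [← two_mul] at this
      simpa [hp] using this
    have hdl : ∀ l, (b l).re = (b j).re * (a l).re := by
      intro l
      have := hd p l
      rw [hdp, mul_zero, add_zero] at this
      have := (mul_eq_zero.1 this).resolve_left hp
      linarith
    have hbc : ∀ l, b l = (b j).re * star (a l) := by
      intro l
      refine Complex.ext ?_ ?_
      · simp [hdl l]
      · simp [hbl l]
    refine ⟨(b j).re / Complex.normSq (g j), fun l => ?_⟩
    have h1 := hbc l
    have h2 : star (g j) ≠ 0 := by simpa using hj
    simp only [ha, star_div₀] at h1
    have h3 : ((Complex.normSq (g j) : ℝ) : ℂ) = g j * star (g j) := (Complex.mul_conj _).symm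
    push_cast
    rw [h3]
    have h4 : z l * g j = (b j).re * (star (g l) / star (g j)) := h1
    field_simp
    field_simp at h4
    linear_combination h4

/-- Selecting rows of a product and pairing with vectors on both sides. -/
lemma dotProduct_submatrix_mulVec {s : ℕ} (e : Fin s → Fin N) (X : Matrix (Fin N) (Fin s) ℂ)
    (β α : Fin s → ℂ) :
    β ⬝ᵥ X.submatrix e id *ᵥ α =
      (β ᵥ* (1 : Matrix (Fin N) (Fin N) ℂ).submatrix e id) ⬝ᵥ X *ᵥ α := by
  rw [← Matrix.dotProduct_mulVec]
  congr 1
  rw [Matrix.mulVec_mulVec]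
  congr 1
  ext i j
  simp [Matrix.mul_apply, Matrix.one_apply]

lemma submatrix_succ_succ {R : Type*} {s : ℕ} (X : Matrix (Fin N) (Fin (s + 1)) R)
    (e : Fin (s + 1) → Fin N) :
    (X.submatrix e id).submatrix (Fin.succAbove 0) (Fin.succAbove 0) =
      (X.submatrix id Fin.succ).submatrix (e ∘ Fin.succ) id := by
  ext i j
  simp

/-- First-order condition for rows of `φ ((A - iB)⁻¹ Y)` that are dependent for all `B`. -/
lemma adjugate_mul_derivative_mul_adjugate {𝕜 : Type*} [RCLike 𝕜] (φ : ℂ →L[ℝ] 𝕜)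
    (hA : A.IsSymm) (hR : (rePart A).PosDef) {s : ℕ} {e : Fin s → Fin N}
    {Y : Matrix (Fin N) (Fin s) ℂ}
    (hzero : ∀ B ∈ fullySet N, (((resolvent A B * Y).submatrix e id).map φ).det = 0)
    {B H : Matrix (Fin N) (Fin N) ℝ} (hB : B.IsSymm) (hH : H.IsSymm) :
    (((resolvent A B * Y).submatrix e id).map φ).adjugate *
      ((resolvent A B * (Complex.I • toC H) * resolvent A B * Y).submatrix e id).map φ *
      (((resolvent A B * Y).submatrix e id).map φ).adjugate = 0 := by
  have hc := continuousAt_resolvent_add_smul (H := H) hA hR hB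
  have hcont : ∀ f : ℝ → Matrix (Fin N) (Fin s) ℂ, ContinuousAt f 0 →
      ContinuousAt (fun t => ((f t).submatrix e id).map φ) 0 := by
    intro f hf
    have : Continuous fun X : Matrix (Fin N) (Fin s) ℂ => (X.submatrix e id).map φ :=
      (Continuous.matrix_submatrix continuous_id _ _).matrix_map φ.continuous
    exact this.continuousAt.comp hf
  have hmul : ∀ {l m k : Type} [Fintype m] (f : ℝ → Matrix l m ℂ) (X : Matrix m k ℂ),
      ContinuousAt f 0 → ContinuousAt (fun t => f t * X) 0 := by
    intro l m k _ f X hf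
    have : Continuous fun Z : Matrix l m ℂ => Z * X := continuous_id.matrix_mul continuous_const
    exact this.continuousAt.comp hf
  have hmul' : ContinuousAt
      (fun t : ℝ => resolvent A B * (Complex.I • toC H) * resolvent A (B + t • H)) 0 := by
    have : Continuous fun Z : Matrix (Fin N) (Fin N) ℂ =>
      resolvent A B * (Complex.I • toC H) * Z := continuous_const.matrix_mul continuous_id
    exact this.continuousAt.comp hc
  have := adjugate_mul_mul_adjugate_eq_zero (𝕜 := 𝕜)
    (M := fun t => ((resolvent A (B + t • H) * Y).submatrix e id).map φ)
    (D := fun t => ((resolvent A B * (Complex.I • toC H) * resolvent A (B + t • H) *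
      Y).submatrix e id).map φ) (hcont _ (hmul _ _ hc)) (hcont _ (hmul _ _ hmul')) ?_ ?_
  · simpa using this
  · intro t
    have h := congrArg (fun X => X * Y) (resolvent_add_smul hA hR hB hH t)
    simp only [Matrix.add_mul, Matrix.smul_mul] at h
    rw [h, zero_smul, add_zero]
    ext i j
    exact (φ.map_add _ _).trans (congrArg _ (φ.map_smul _ _))
  · exact fun t => hzero _ (hB.add (hH.smul t))

lemma apply_eq_dotProduct_mulVec {R : Type*} [CommRing R] {s : ℕ} (X Y Z : Matrix (Fin s) (Fin s) R)
    (i j : Fin s) : (X * Y * Z) i j = (fun a => X i a) ⬝ᵥ Y *ᵥ fun a => Z a j := by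
  rw [Matrix.dotProduct_mulVec]
  simp [Matrix.mul_apply, Matrix.vecMul, dotProduct]

lemma dotProduct_derivative_mulVec {s : ℕ} (e : Fin s → Fin N) (G H : Matrix (Fin N) (Fin N) ℂ)
    (Y : Matrix (Fin N) (Fin s) ℂ) (β α : Fin s → ℂ) :
    β ⬝ᵥ (G * (Complex.I • H) * G * Y).submatrix e id *ᵥ α =
      Complex.I * (((β ᵥ* (1 : Matrix (Fin N) (Fin N) ℂ).submatrix e id) ᵥ* G) ⬝ᵥ
        H *ᵥ (G *ᵥ (Y *ᵥ α))) := by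
  rw [dotProduct_submatrix_mulVec]
  simp only [← Matrix.mulVec_mulVec, ← Matrix.dotProduct_mulVec, Matrix.smul_mulVec,
    Matrix.mulVec_smul, dotProduct_smul, smul_eq_mul]

lemma vecMul_resolvent_ne_zero (hA : A.IsSymm) (hR : (rePart A).PosDef)
    {B : Matrix (Fin N) (Fin N) ℝ} (hB : B.IsSymm) {β : Fin N → ℂ} (hβ : β ≠ 0) :
    β ᵥ* resolvent A B ≠ 0 := by
  intro h
  apply hβ
  have := congrArg (fun v => v ᵥ* (A - Complex.I • toC B)) h
  simpa [Matrix.vecMul_vecMul, resolvent_mul_self hA hR hB] using this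

lemma resolvent_mulVec_ne_zero (hA : A.IsSymm) (hR : (rePart A).PosDef)
    {B : Matrix (Fin N) (Fin N) ℝ} (hB : B.IsSymm) {x : Fin N → ℂ} (hx : x ≠ 0) :
    resolvent A B *ᵥ x ≠ 0 := by
  intro h
  apply hx
  have := congrArg (fun v => (A - Complex.I • toC B) *ᵥ v) h
  simpa [Matrix.mulVec_mulVec, self_mul_resolvent hA hR hB] using this

lemma vecMul_submatrix_one_apply {s : ℕ} (e : Fin s ↪ Fin N) (β : Fin s → ℂ) (a : Fin s) :
    (β ᵥ* (1 : Matrix (Fin N) (Fin N) ℂ).submatrix e id) (e a) = β a := by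
  simp [Matrix.vecMul, dotProduct, Matrix.one_apply]

/-- For some configuration, the given rows of `(A - iB)⁻¹ Y` are independent if the columns of `Y`
are. -/
lemma exists_det_resolvent_mul_ne_zero (hA : A.IsSymm) (hR : (rePart A).PosDef) :
    ∀ {s : ℕ} (e : Fin s ↪ Fin N) (Y : Matrix (Fin N) (Fin s) ℂ),
      (∀ α : Fin s → ℂ, Y *ᵥ α = 0 → α = 0) →
      ∃ B ∈ fullySet N, ((resolvent A B * Y).submatrix e id).det ≠ 0
  | 0, _, _, _ => ⟨0, Matrix.isSymm_zero, by simp⟩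
  | s + 1, e, Y, hY => by
    obtain ⟨B, hB, hdet⟩ := exists_det_resolvent_mul_ne_zero hA hR
      ((Fin.succEmb s).trans e) (Y.submatrix id Fin.succ) (fun α hα => by
        have := hY (Fin.cons 0 α) (by
          rw [← hα]
          ext i
          simp [Matrix.mulVec, dotProduct, Fin.sum_univ_succ])
        funext j
        simpa using congrFun this j.succ)
    by_contra! hzero
    set M0 := (resolvent A B * Y).submatrix e id with hM0
    -- This entry is, up to sign, the smaller minor from the induction hypothesis. Row and column
    -- `0` of the adjugate are therefore non-zero and serve as `β` and `α`.
    have hadj : M0.adjugate 0 0 ≠ 0 := by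
      rw [adjugate_fin_succ_eq_det_submatrix, hM0, submatrix_succ_succ]
      exact mul_ne_zero (by simp) hdet
    have hsym : ∀ H : Matrix (Fin N) (Fin N) ℝ, H.IsSymm →
        (((fun a => M0.adjugate 0 a) ᵥ* (1 : Matrix (Fin N) (Fin N) ℂ).submatrix e id) ᵥ*
          resolvent A B) ⬝ᵥ toC H *ᵥ (resolvent A B *ᵥ (Y *ᵥ fun a => M0.adjugate a 0)) = 0 := by
      intro H hH
      have h := adjugate_mul_derivative_mul_adjugate (ContinuousLinearMap.id ℝ ℂ) hA hR
        (e := e) (Y := Y) (by simpa using hzero) hB hH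
      have h00 := congrFun (congrFun h 0) 0
      rw [apply_eq_dotProduct_mulVec] at h00
      have h1 := dotProduct_derivative_mulVec e (resolvent A B) (toC H) Y
        (fun a => M0.adjugate 0 a) (fun a => M0.adjugate a 0)
      have h2 : Complex.I * _ = 0 := h1.symm.trans (by simpa [← hM0] using h00)
      exact (mul_eq_zero.1 h2).resolve_left Complex.I_ne_zero
    rcases eq_zero_or_eq_zero_of_symm_mul fun j l =>
      (dotProduct_single_add_single_mulVec _ _ j l).symm.trans
        (hsym _ (isSymm_single_add_single j l)) with h | h
    · refine vecMul_resolvent_ne_zero hA hR hB (fun h0 => hadj ?_) h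
      simpa [vecMul_submatrix_one_apply] using congrFun h0 (e 0)
    · refine resolvent_mulVec_ne_zero hA hR hB (fun h0 => hadj ?_) h
      exact congrFun (hY _ h0) 0

/-- For some configuration, the given rows of `(A - iB)⁻¹ Y` have the same kernel as `Y`. -/
lemma exists_normSq_det_resolvent_ne_zero (hA : A.IsSymm) (hR : (rePart A).PosDef) {s : ℕ}
    (e : Fin s ↪ Fin N) (Y : Matrix (Fin N) (Fin s) ℂ) :
    ∃ F : Matrix (Fin N) (Fin N) ℝ → ℝ, IsRegular realCoords (fullySet N) F ∧
      (∃ B ∈ fullySet N, F B ≠ 0) ∧ ∀ B, F B ≠ 0 → ∀ α : Fin s → ℂ,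
        (∀ a, (resolvent A B *ᵥ (Y *ᵥ α)) (e a) = 0) → Y *ᵥ α = 0 := by
  have hs : s ≤ N := by simpa using Fintype.card_le_of_embedding e
  -- The columns of `Y` may be dependent over `ℂ` although independent over `ℝ`, as for a column and
  -- its multiple by `-i`; only the independent factor can be tested by a determinant.
  obtain ⟨T, C, hC, hTC⟩ := exists_eq_mul_linearIndependent_rows hs Yᵀ
  have hY : Y = Cᵀ * Tᵀ := by rw [← Matrix.transpose_mul, ← hTC, Matrix.transpose_transpose]
  refine ⟨fun B => Complex.normSq ((resolvent A B * Cᵀ).submatrix e id).det,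
    (IsRegularC.det fun i j => isRegularC_resolvent_mul hA hR _ _ _).normSq, ?_,
    fun B hB α hα => ?_⟩
  · obtain ⟨B, hB, h⟩ := exists_det_resolvent_mul_ne_zero hA hR e Cᵀ fun α hα =>
      eq_zero_of_vecMul_eq_zero hC (by rwa [Matrix.mulVec_transpose] at hα)
    exact ⟨B, hB, by simpa using h⟩
  · have hdet : ((resolvent A B * Cᵀ).submatrix e id).det ≠ 0 := by simpa using hB
    have : Tᵀ *ᵥ α = 0 := by
      refine Matrix.eq_zero_of_mulVec_eq_zero hdet (funext fun a => ?_)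
      refine Eq.trans ?_ (hα a)
      rw [hY, ← Matrix.mulVec_mulVec, Matrix.mulVec_mulVec (M := resolvent A B)]
      rfl
    rw [hY, ← Matrix.mulVec_mulVec, this, Matrix.mulVec_zero]

/-- For some configuration, the given rows of `Re ((A - iB)⁻¹ Y)` are independent if the columns
of `Y` are independent over `ℝ`. -/
lemma exists_det_rePart_resolvent_mul_ne_zero (hA : A.IsSymm) (hR : (rePart A).PosDef) :
    ∀ {s : ℕ} (e : Fin s ↪ Fin N) (Y : Matrix (Fin N) (Fin s) ℂ),
      (∀ α : Fin s → ℝ, Y *ᵥ (fun j => (α j : ℂ)) = 0 → α = 0) →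
      ∃ B ∈ fullySet N, (((resolvent A B * Y).submatrix e id).map Complex.re).det ≠ 0
  | 0, _, _, _ => ⟨0, Matrix.isSymm_zero, by simp⟩
  | s + 1, e, Y, hY => by
    have ih := exists_det_rePart_resolvent_mul_ne_zero hA hR
      ((Fin.succEmb s).trans e) (Y.submatrix id Fin.succ) (fun α hα => by
        have := hY (Fin.cons 0 α) (by
          rw [← hα]
          ext i
          simp [Matrix.mulVec, dotProduct, Fin.sum_univ_succ])
        funext j
        simpa using congrFun this j.succ)
    obtain ⟨F, hF, hF0, hFY⟩ := exists_normSq_det_resolvent_ne_zero hA hR e Y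
    -- One `B` has to meet two generic conditions: the smaller real minor is non-zero, and the
    -- chosen complex rows lose nothing of the kernel of `Y`.
    obtain ⟨B, hB, hdet, hFB⟩ := (isIrreducibleIn_fullySet N).exists_ne_zero
      (IsRegular.det fun i j => (isRegularC_resolvent_mul hA hR _ _ _).1) hF ih hF0
    by_contra! hzero
    set M0 := ((resolvent A B * Y).submatrix e id).map Complex.re with hM0
    have hadj : M0.adjugate 0 0 ≠ 0 := by
      rw [adjugate_fin_succ_eq_det_submatrix, hM0, Matrix.submatrix_map, submatrix_succ_succ]
      exact mul_ne_zero (by simp) hdet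
    set β : Fin (s + 1) → ℝ := fun a => M0.adjugate 0 a with hβ
    set α : Fin (s + 1) → ℝ := fun a => M0.adjugate a 0 with hα
    set β' : Fin N → ℂ := (fun a => (β a : ℂ)) ᵥ* (1 : Matrix (Fin N) (Fin N) ℂ).submatrix e id
      with hβ'
    set g := β' ᵥ* resolvent A B with hg
    set x := Y *ᵥ fun a => (α a : ℂ) with hx
    set z := resolvent A B *ᵥ x with hz
    have hx0 : x ≠ 0 := fun h0 => hadj (congrFun (hY _ h0) 0)
    have hz0 : z ≠ 0 := resolvent_mulVec_ne_zero hA hR hB hx0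
    have hg0 : g ≠ 0 := by
      refine vecMul_resolvent_ne_zero hA hR hB fun h0 => hadj ?_
      simpa [hβ', vecMul_submatrix_one_apply] using congrFun h0 (e 0)
    have re_mulVec : ∀ (X : Matrix (Fin (s + 1)) (Fin (s + 1)) ℂ) (i : Fin (s + 1)),
        (X.map Complex.re *ᵥ α) i = ((X *ᵥ fun a => (α a : ℂ)) i).re := by
      intro X i
      simp [Matrix.mulVec, dotProduct]
    have hsym : ∀ H : Matrix (Fin N) (Fin N) ℝ, H.IsSymm → (g ⬝ᵥ toC H *ᵥ z).im = 0 := by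
      intro H hH
      have h := adjugate_mul_derivative_mul_adjugate Complex.reCLM hA hR
        (e := e) (Y := Y) hzero hB hH
      have h00 := congrFun (congrFun h 0) 0
      rw [apply_eq_dotProduct_mulVec] at h00
      have h1 := dotProduct_derivative_mulVec e (resolvent A B) (toC H) Y
        (fun a => (β a : ℂ)) (fun a => (α a : ℂ))
      have h2 : β ⬝ᵥ (((resolvent A B * (Complex.I • toC H) * resolvent A B *
          Y).submatrix e id).map Complex.re) *ᵥ α = 0 := h00
      have h3 := congrArg Complex.re h1
      rw [← hβ', ← hg, ← hx, ← hz] at h3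
      simp only [Complex.mul_re, Complex.I_re, Complex.I_im, zero_mul, one_mul, zero_sub] at h3
      have h4 : ∀ v : Fin (s + 1) → ℂ, ((fun a => (β a : ℂ)) ⬝ᵥ v).re = β ⬝ᵥ fun a => (v a).re := by
        intro v
        simp [dotProduct]
      rw [h4, ← funext (re_mulVec _), h2] at h3
      linarith
    have hre : ∀ a, (z (e a)).re = 0 := by
      intro a
      have h1 : M0 *ᵥ α = 0 := by
        have : M0 * M0.adjugate = 0 := by
          rw [Matrix.mul_adjugate, hzero B hB, zero_smul]
        funext i
        have := congrFun (congrFun this i) 0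
        rwa [Matrix.mul_apply] at this
      have h2 := congrFun h1 a
      rw [hM0, re_mulVec] at h2
      rw [hz, hx, Matrix.mulVec_mulVec]
      exact h2
    -- Since `(A - iB) g = β'`, the sum is the real part of the accretive form of `A - iB` at `g`.
    have hpos : 0 < ∑ a, (g (e a)).re * β a := by
      have h1 := re_star_dotProduct_mulVec_pos (isSymm_sub_I_smul hA hB)
        (by rwa [rePart_sub_I_smul]) hg0
      have h2 : (A - Complex.I • toC B) *ᵥ g = β' := by
        rw [← Matrix.vecMul_transpose, isSymm_sub_I_smul hA hB, hg, Matrix.vecMul_vecMul,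
          resolvent_mul_self hA hR hB, Matrix.vecMul_one]
      rw [h2, hβ', dotProduct_comm, ← Matrix.dotProduct_mulVec] at h1
      refine h1.trans_eq ?_
      simp [dotProduct, Matrix.mulVec, Matrix.one_apply, mul_comm]
    rcases conj_or_real_of_symm_mul_im hg0 fun j l =>
      (congrArg Complex.im (dotProduct_single_add_single_mulVec g z j l)).symm.trans
        (hsym _ (isSymm_single_add_single j l)) with ⟨ρ, hρ⟩ | ⟨ω, g', z', hω, hg', hz'⟩
    -- Conjugate case: `Re z = 0` on the chosen rows reads `ρ * Re g = 0` there, and positivity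
    -- forces `ρ = 0`, hence `z = 0`.
    · have h1 : ρ * ∑ a, (g (e a)).re * β a = 0 := by
        rw [Finset.mul_sum]
        refine Finset.sum_eq_zero fun a _ => ?_
        have := hre a
        rw [hρ] at this
        simp at this
        rcases this with h | h <;> simp [h]
      have h2 : ρ = 0 := (mul_eq_zero.1 h1).resolve_right hpos.ne'
      exact hz0 (funext fun l => by simp [hρ l, h2])
    -- Real case: with `Re ω ≠ 0`, a vanishing real part of `z' / ω` makes `z` itself vanish on the
    -- chosen rows, which the second generic condition excludes.
    · have hωre : ω.re ≠ 0 := by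
        intro h
        simp [hg', h] at hpos
      refine hx0 (hFY B hFB _ fun a => ?_)
      have h1 := hre a
      rw [hz'] at h1
      have h2 : z' (e a) = 0 := by
        rw [Complex.div_re] at h1
        have : Complex.normSq ω ≠ 0 := by simpa using hω
        simp at h1
        rcases h1 with (h | h) | h
        · exact h
        · exact absurd h hωre
        · exact absurd h hω
      change z (e a) = 0
      rw [hz', h2]; simp

end Resolvent

/-! ### Sparsifying a symmetric matrix without changing its product with `M`. -/

section Elimination

variable {n μ : Type*} [Fintype n] [DecidableEq n] [Fintype μ]

/-- A left null vector of `M` that is supported on as many rows as `M` has columns is zero. -/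
def RowsInGeneralPosition (M : Matrix n μ ℝ) : Prop :=
  ∀ T : Finset n, T.card = Fintype.card μ → ∀ v : n → ℝ, (∀ i ∉ T, v i = 0) → v ᵥ* M = 0 → v = 0

/-- One row more than there are columns forces a dependency. A zero coefficient in it would leave a
dependency among only `card μ` rows. -/
lemma RowsInGeneralPosition.exists_null {M : Matrix n μ ℝ} (hM : RowsInGeneralPosition M)
    {T : Finset n} (hT : T.card = Fintype.card μ) {j : n} (hj : j ∉ T) :
    ∃ v : n → ℝ, (∀ i ∉ insert j T, v i = 0) ∧ v ᵥ* M = 0 ∧ ∀ i ∈ insert j T, v i ≠ 0 := by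
  set S := insert j T with hS
  have hcard : S.card = Fintype.card μ + 1 := by rw [hS, Finset.card_insert_of_notMem hj, hT]
  let f : (S → ℝ) →ₗ[ℝ] (μ → ℝ) := (M.submatrix (fun i : S => (i : n)) id).vecMulLinear
  have hker : LinearMap.ker f ≠ ⊥ := LinearMap.ker_ne_bot_of_finrank_lt (by simp [hcard])
  obtain ⟨w, hw, hw0⟩ := (Submodule.ne_bot_iff _).1 hker
  let v : n → ℝ := fun i => if h : i ∈ S then w ⟨i, h⟩ else 0
  have hv : ∀ i ∉ S, v i = 0 := fun i hi => by simp [v, hi]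
  have hvM : v ᵥ* M = 0 := by
    funext a
    have h1 : f w a = 0 := by rw [LinearMap.mem_ker.1 hw]; rfl
    refine Eq.trans ?_ h1
    change ∑ i, v i * M i a = ∑ i : S, w i * M i a
    rw [← Finset.sum_subset (Finset.subset_univ S) fun i _ hi => by simp [hv i hi],
      ← Finset.sum_attach]
    refine Finset.sum_congr rfl fun i _ => ?_
    simp [v]
  refine ⟨v, hv, hvM, fun i hi h0 => hw0 ?_⟩
  have : v = 0 := by
    refine hM (S.erase i) (by rw [Finset.card_erase_of_mem hi, hcard]; simp) v (fun p hp => ?_) hvM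
    by_cases hpi : p = i
    · rw [hpi, h0]
    · exact hv p fun h => hp (Finset.mem_erase.2 ⟨hpi, h⟩)
  funext p
  simpa [v] using congrFun this p

/-- Clearing the entries of one row of `B` by a symmetric matrix that annihilates `M`. -/
lemma RowsInGeneralPosition.exists_clear_row {M : Matrix n μ ℝ} (hM : RowsInGeneralPosition M)
    {R J T : Finset n} (hT : T.card = Fintype.card μ) {i : n} (hi : i ∈ T) (hTR : T ⊆ R)
    (hJR : J ⊆ R) (hJT : Disjoint J T) {B : Matrix n n ℝ} (hB : B.IsSymm) :
    ∃ B' : Matrix n n ℝ, B'.IsSymm ∧ B' * M = B * M ∧ (∀ j ∈ J, B' i j = 0) ∧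
      ∀ p ∉ R, ∀ q, B' p q = B p q := by
  have hex : ∀ j : n, ∃ v : n → ℝ, j ∈ J → (∀ i ∉ insert j T, v i = 0) ∧ v ᵥ* M = 0 ∧
      ∀ i ∈ insert j T, v i ≠ 0 := by
    intro j
    by_cases hj : j ∈ J
    · obtain ⟨v, hv⟩ := hM.exists_null hT (Finset.disjoint_left.1 hJT hj)
      exact ⟨v, fun _ => hv⟩
    · exact ⟨0, fun h => absurd h hj⟩
  choose v hv using hex
  -- Each `v l` with `l ≠ j` vanishes at `j`, so the summands clear their entries of row `i`
  -- independently of each other.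
  set E : Matrix n n ℝ := ∑ j ∈ J, (B i j / (v j i * v j j)) • Matrix.vecMulVec (v j) (v j) with hE
  refine ⟨B - E, hB.sub ?_, ?_, fun j hj => ?_, fun p hp q => ?_⟩
  · rw [Matrix.IsSymm, hE, Matrix.transpose_sum]
    exact Finset.sum_congr rfl fun j _ => by
      rw [Matrix.transpose_smul, Matrix.transpose_vecMulVec]
  · have : E * M = 0 := by
      rw [hE, Matrix.sum_mul]
      refine Finset.sum_eq_zero fun j hj => ?_
      rw [Matrix.smul_mul, Matrix.vecMulVec_mul, (hv j hj).2.1]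
      ext p q
      simp [Matrix.vecMulVec_apply]
    rw [Matrix.sub_mul, this, sub_zero]
  · have hEij : E i j = B i j := by
      rw [hE, Matrix.sum_apply, Finset.sum_eq_single j]
      · have h1 := (hv j hj).2.2 i (Finset.mem_insert_of_mem hi)
        have h2 := (hv j hj).2.2 j (Finset.mem_insert_self _ _)
        simp only [Matrix.smul_apply, Matrix.vecMulVec_apply, smul_eq_mul]
        field_simp
      · intro l hl hlj
        have : v l j = 0 := (hv l hl).1 j fun h => by
          rcases Finset.mem_insert.1 h with h | h
          · exact hlj h.symm
          · exact Finset.disjoint_left.1 hJT hj h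
        simp [Matrix.vecMulVec_apply, this]
      · exact fun h => absurd hj h
    rw [Matrix.sub_apply, hEij, sub_self]
  · have : E p q = 0 := by
      rw [hE, Matrix.sum_apply]
      refine Finset.sum_eq_zero fun j hj => ?_
      have : v j p = 0 := (hv j hj).1 p fun h => by
        rcases Finset.mem_insert.1 h with h | h
        · exact hp (h ▸ hJR hj)
        · exact hp (hTR h)
      simp [Matrix.vecMulVec_apply, this]
    rw [Matrix.sub_apply, this, sub_zero]

/-- If the elements can be removed one by one such that each is linked to all remaining ones, or to
as many as `M` has columns (counting itself), then every `B * M` with `B` symmetric is attained by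
a symmetric matrix that is supported on the links. -/
lemma RowsInGeneralPosition.exists_supported {M : Matrix n μ ℝ} (hM : RowsInGeneralPosition M)
    (hμ : 1 ≤ Fintype.card μ) (link : n → n → Prop) [DecidableRel link]
    (hrefl : ∀ i, link i i) (hsymm : ∀ i j, link i j → link j i) (Good : Finset n → Prop)
    (hGood : ∀ R, Good R → R.Nonempty → ∃ i ∈ R, Good (R.erase i) ∧
      ((∀ j ∈ R, link i j) ∨ Fintype.card μ ≤ (R.filter (link i)).card))
    (huniv : Good Finset.univ) {B : Matrix n n ℝ} (hB : B.IsSymm) :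
    ∃ B' : Matrix n n ℝ, B'.IsSymm ∧ B' * M = B * M ∧ ∀ i j, ¬ link i j → B' i j = 0 := by
  -- Invariant: the rows of removed elements are already supported on links. Later corrections are
  -- supported on `R × R` and do not disturb them.
  have key : ∀ (c : ℕ) (R : Finset n), R.card = c → Good R → ∀ B : Matrix n n ℝ, B.IsSymm →
      (∀ p ∉ R, ∀ q, ¬ link p q → B p q = 0) →
      ∃ B' : Matrix n n ℝ, B'.IsSymm ∧ B' * M = B * M ∧ ∀ i j, ¬ link i j → B' i j = 0 := by
    intro c
    induction c with
    | zero =>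
      intro R hR _ B hB hBR
      rw [Finset.card_eq_zero] at hR
      exact ⟨B, hB, rfl, fun i => hBR i (by simp [hR])⟩
    | succ c ih =>
      intro R hR hgR B hB hBR
      obtain ⟨i, hi, hgi, hor⟩ := hGood R hgR (Finset.card_pos.1 (by omega))
      have hc : (R.erase i).card = c := by rw [Finset.card_erase_of_mem hi, hR]; rfl
      have step : ∃ B' : Matrix n n ℝ, B'.IsSymm ∧ B' * M = B * M ∧
          (∀ j ∈ R, ¬ link i j → B' i j = 0) ∧ ∀ p ∉ R, ∀ q, B' p q = B p q := by
        rcases hor with hall | hcard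
        · exact ⟨B, hB, rfl, fun j hj h => absurd (hall j hj) h, fun _ _ _ => rfl⟩
        · obtain ⟨T, hiT, hTR, hTc⟩ := Finset.exists_subsuperset_card_eq
            (Finset.singleton_subset_iff.2 (Finset.mem_filter.2 ⟨hi, hrefl i⟩))
            (by simpa using hμ) hcard
          obtain ⟨B', h1, h2, h3, h4⟩ := hM.exists_clear_row (R := R)
            (J := R.filter fun j => ¬ link i j) hTc (Finset.singleton_subset_iff.1 hiT)
            (hTR.trans (Finset.filter_subset _ _)) (Finset.filter_subset _ _)
            (Finset.disjoint_left.2 fun j hj hjT =>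
              (Finset.mem_filter.1 hj).2 (Finset.mem_filter.1 (hTR hjT)).2) hB
          exact ⟨B', h1, h2, fun j hj hl => h3 j (Finset.mem_filter.2 ⟨hj, hl⟩), h4⟩
      obtain ⟨B', h1, h2, h3, h4⟩ := step
      obtain ⟨B'', h1', h2', h3'⟩ := ih (R.erase i) hc hgi B' h1 (by
        intro p hp q hpq
        by_cases hpR : p ∈ R
        · obtain rfl : p = i := by
            by_contra h
            exact hp (Finset.mem_erase.2 ⟨h, hpR⟩)
          by_cases hq : q ∈ R
          · exact h3 q hq hpq
          · rw [← h1.apply, h4 q hq]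
            exact hBR q hq p fun h => hpq (hsymm _ _ h)
        · rw [h4 p hpR]
          exact hBR p hpR q hpq)
      exact ⟨B'', h1', h2'.trans h2, h3'⟩
  exact key _ _ rfl huniv B hB (by simp)

end Elimination

/-! ### Elimination orders for bands and connected graphs. -/

section Architectures

variable {N : ℕ} {μ : Type*} [Fintype μ]

/-- Elements are removed in increasing order. The smallest remaining `a` is linked to all remaining
elements, or to the `q + 1` elements `a, …, a + q`, itself included. For `N ≤ q + 1` the band is no
restriction. -/
lemma exists_mem_bandSet {q : ℕ} {M : Matrix (Fin N) μ ℝ}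
    (hM : N ≤ q + 1 ∨ RowsInGeneralPosition M ∧ Fintype.card μ ≤ q + 1)
    (hμ : 1 ≤ Fintype.card μ) {B : Matrix (Fin N) (Fin N) ℝ} (hB : B.IsSymm) :
    ∃ B' ∈ bandSet N q, B' * M = B * M := by
  rcases hM with hN | ⟨hM, hq⟩
  · refine ⟨B, ⟨hB, fun i j hij => ?_⟩, rfl⟩
    rw [lt_abs] at hij
    omega
  refine Exists.imp ?_ (hM.exists_supported hμ
    (fun i j : Fin N => (i : ℕ) ≤ j + q ∧ (j : ℕ) ≤ i + q) (fun i => by omega)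
    (fun i j h => h.symm)
    (fun R => ∃ a : ℕ, R = Finset.univ.filter fun i : Fin N => a ≤ i) ?_ ⟨0, by simp⟩ hB)
  · rintro B' ⟨h1, h2, h3⟩
    refine ⟨⟨h1, fun i j hij => h3 i j ?_⟩, h2⟩
    rw [lt_abs] at hij
    omega
  · rintro R ⟨a, rfl⟩ ⟨b, hb⟩
    have hab : a ≤ b := by simpa using hb
    have haN : a < N := by omega
    refine ⟨⟨a, haN⟩, by simp, ⟨a + 1, ?_⟩, ?_⟩
    · ext i
      simp [Fin.ext_iff]
      omega
    · by_cases h : N ≤ a + q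
      · left
        intro j hj
        have : a ≤ j := by simpa using hj
        have := j.2
        constructor <;> dsimp only <;> omega
      · right
        have hsub : Finset.Icc (⟨a, haN⟩ : Fin N) ⟨a + q, by omega⟩ ⊆
            (Finset.univ.filter fun i : Fin N => a ≤ i).filter
              fun j : Fin N => a ≤ j + q ∧ (j : ℕ) ≤ a + q := by
          intro j hj
          simp [Fin.le_def] at hj ⊢
          omega
        refine le_trans ?_ (Finset.card_le_card hsub)
        rw [Fin.card_Icc]
        simp
        omega

lemma exists_adj_dist_lt {V : Type*} {G : SimpleGraph V} (hG : G.Connected) {r i : V}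
    (hi : i ≠ r) : ∃ j, G.Adj i j ∧ G.dist r j < G.dist r i := by
  obtain ⟨w, hw⟩ := hG.exists_walk_length_eq_dist i r
  cases w with
  | nil => exact absurd rfl hi
  | @cons _ j _ h p =>
    refine ⟨j, h, ?_⟩
    rw [SimpleGraph.dist_comm (u := r) (v := i), ← hw, SimpleGraph.dist_comm]
    exact Nat.lt_succ_of_le (SimpleGraph.dist_le p)

/-- Remove an element farthest from a root `r`. Together with its remaining neighbour closer to `r`
it makes up the two rows needed; the root goes last, when it is alone. Connectedness is all that
this uses. -/
lemma RowsInGeneralPosition.exists_mem_graphSet {M : Matrix (Fin N) μ ℝ}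
    (hM : RowsInGeneralPosition M) (hμ : Fintype.card μ = 2) {G : SimpleGraph (Fin N)}
    (hG : G.Connected) {B : Matrix (Fin N) (Fin N) ℝ} (hB : B.IsSymm) :
    ∃ B' ∈ graphSet G, B' * M = B * M := by
  classical
  obtain ⟨r⟩ := hG.nonempty
  refine Exists.imp ?_ (hM.exists_supported (by omega)
    (fun i j : Fin N => i = j ∨ G.Adj i j) (fun i => Or.inl rfl)
    (fun i j h => h.imp Eq.symm fun h => h.symm)
    (fun R => ∀ i ∈ R, i ≠ r → ∃ j ∈ R, G.Adj i j ∧ G.dist r j < G.dist r i) ?_ ?_ hB)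
  · rintro B' ⟨h1, h2, h3⟩
    exact ⟨⟨h1, fun i j hij hadj => h3 i j (by tauto)⟩, h2⟩
  · intro R hR hne
    obtain ⟨i, hi, hmax⟩ := Finset.exists_max_image R (G.dist r) hne
    refine ⟨i, hi, fun p hp hpr => ?_, ?_⟩
    · obtain ⟨j, hj, hadj, hlt⟩ := hR p (Finset.mem_of_mem_erase hp) hpr
      refine ⟨j, Finset.mem_erase.2 ⟨?_, hj⟩, hadj, hlt⟩
      rintro rfl
      exact absurd (hmax p (Finset.mem_of_mem_erase hp)) (not_le.2 hlt)
    · by_cases hir : i = r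
      · left
        intro j hj
        have := hmax j hj
        rw [hir, SimpleGraph.dist_self, Nat.le_zero, hG.dist_eq_zero_iff] at this
        exact Or.inl (hir.trans this)
      · right
        obtain ⟨j, hj, hadj, -⟩ := hR i hi hir
        rw [hμ, ← Finset.card_pair hadj.ne]
        refine Finset.card_le_card fun p hp => ?_
        rcases Finset.mem_insert.1 hp with rfl | hp
        · simp [hi]
        · rw [Finset.mem_singleton.1 hp]
          simp [hj, hadj]
  · intro i _ hi
    obtain ⟨j, h⟩ := exists_adj_dist_lt hG hi
    exact ⟨j, Finset.mem_univ j, h⟩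

lemma rowsInGeneralPosition_of_not_hasSingularSubmatrix {M : Matrix (Fin N) μ ℝ}
    (hM : ¬ HasSingularSubmatrix M) : RowsInGeneralPosition M := by
  intro T hT v hv hvM
  have hdet : (M.submatrix (T.orderEmbOfFin hT) (Fintype.equivFin μ).symm).det ≠ 0 := fun h =>
    hM ⟨_, (T.orderEmbOfFin hT).toEmbedding, (Fintype.equivFin μ).symm.toEmbedding, h⟩
  have h0 : v ∘ T.orderEmbOfFin hT = 0 := by
    refine Matrix.eq_zero_of_vecMul_eq_zero hdet (funext fun a => ?_)
    have h1 := congrFun hvM ((Fintype.equivFin μ).symm a)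
    refine Eq.trans ?_ h1
    change ∑ i, v (T.orderEmbOfFin hT i) * M (T.orderEmbOfFin hT i) _ = ∑ i, v i * M i _
    rw [← Finset.sum_subset (Finset.subset_univ T) fun i _ hi => by simp [hv i hi]]
    conv_rhs => rw [← Finset.image_orderEmbOfFin_univ T hT]
    rw [Finset.sum_image fun a _ b _ h => (T.orderEmbOfFin hT).injective h]
  funext i
  by_cases hi : i ∈ T
  · rw [← Finset.image_orderEmbOfFin_univ T hT] at hi
    obtain ⟨a, -, rfl⟩ := Finset.mem_image.1 hi
    exact congrFun h0 a
  · exact hv i hi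

end Architectures

/-! ### Schur complements and passage between real and complex matrices. -/

section Schur

variable {m n : Type*} [Fintype m] [Fintype n] [DecidableEq n]

lemma re_dotProduct_mulVec_ofReal (A : Matrix m m ℂ) (v : m → ℝ) :
    (star (fun i => (v i : ℂ)) ⬝ᵥ A *ᵥ fun i => (v i : ℂ)).re = v ⬝ᵥ rePart A *ᵥ v := by
  simp [dotProduct, mulVec, rePart]

/-- Schur complements of complex symmetric matrices with positive definite real part are of the
same kind. -/
lemma schur_isSymm_and_posDef {A : Matrix m m ℂ} {B : Matrix m n ℂ} {C : Matrix n m ℂ}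
    {D : Matrix n n ℂ} (hsymm : (fromBlocks A B C D).IsSymm)
    (hre : (rePart (fromBlocks A B C D)).PosDef) :
    D.det ≠ 0 ∧ (A - B * D⁻¹ * C).IsSymm ∧ (rePart (A - B * D⁻¹ * C)).PosDef := by
  obtain ⟨hA, hBC, hCB, hD⟩ := Matrix.isSymm_fromBlocks_iff.1 hsymm
  have hDre : (rePart D).PosDef := hre.submatrix (e := Sum.inr) Sum.inr_injective
  have hdet := det_ne_zero_of_rePart_posDef hD hDre
  have hS : (A - B * D⁻¹ * C).IsSymm := by
    rw [Matrix.IsSymm, Matrix.transpose_sub, Matrix.transpose_mul, Matrix.transpose_mul,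
      Matrix.transpose_nonsing_inv, hA, hD, hBC, hCB, Matrix.mul_assoc]
  refine ⟨hdet, hS, Matrix.PosDef.of_dotProduct_mulVec_pos ?_ fun v hv => ?_⟩
  · refine Matrix.IsHermitian.ext fun i j => ?_
    simp [rePart, hS.apply]
  · rw [star_trivial, ← re_dotProduct_mulVec_ofReal]
    set v' : m → ℂ := fun i => (v i : ℂ) with hv'
    -- With this second block the lower half of the product vanishes, so the form of the full matrix
    -- at `x` equals that of the Schur complement at `v'`.
    set x : m ⊕ n → ℂ := Sum.elim v' (-(D⁻¹ *ᵥ (C *ᵥ v'))) with hx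
    have hx0 : x ≠ 0 := fun h => hv (funext fun i => by
      have := congrFun h (Sum.inl i)
      simpa [hx, hv'] using this)
    refine (re_star_dotProduct_mulVec_pos hsymm hre hx0).trans_eq ?_
    have hmul : fromBlocks A B C D *ᵥ x = Sum.elim ((A - B * D⁻¹ * C) *ᵥ v') 0 := by
      rw [hx, Matrix.fromBlocks_mulVec]
      congr 1
      · rw [Sum.elim_comp_inl, Sum.elim_comp_inr, Matrix.mulVec_neg, Matrix.mulVec_mulVec,
          Matrix.mulVec_mulVec, Matrix.sub_mulVec, sub_eq_add_neg]
      · simp only [Sum.elim_comp_inl, Sum.elim_comp_inr, Matrix.mulVec_neg, Matrix.mulVec_mulVec]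
        rw [← Matrix.mul_assoc, Matrix.mul_nonsing_inv _ (Ne.isUnit hdet), Matrix.one_mul,
          add_neg_cancel]
    rw [hmul]
    simp [dotProduct, hx]

end Schur

lemma rePart_toC_mul {l m n : Type*} [Fintype m] (P : Matrix l m ℝ) (X : Matrix m n ℂ) :
    rePart (toC P * X) = P * rePart X := by
  ext i j
  simp [rePart, toC, Matrix.mul_apply]

lemma imPart_toC_mul {l m n : Type*} [Fintype m] (P : Matrix l m ℝ) (X : Matrix m n ℂ) :
    imPart (toC P * X) = P * imPart X := by
  ext i j
  simp [imPart, toC, Matrix.mul_apply]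

lemma toC_mul {l m n : Type*} [Fintype m] (P : Matrix l m ℝ) (Q : Matrix m n ℝ) :
    toC (P * Q) = toC P * toC Q := by
  ext i j
  simp [toC, Matrix.mul_apply]

lemma toC_one {m : Type*} [DecidableEq m] : toC (1 : Matrix m m ℝ) = 1 := by
  ext i j
  simp [toC, Matrix.one_apply, apply_ite]

lemma toC_rePart_add_imPart {m n : Type*} (X : Matrix m n ℂ) :
    toC (rePart X) + Complex.I • toC (imPart X) = X := by
  ext i j
  simp [toC, rePart, imPart, mul_comm Complex.I]

lemma eq_of_rePart_eq_of_imPart_eq {m n : Type*} {X Y : Matrix m n ℂ}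
    (h1 : rePart X = rePart Y) (h2 : imPart X = imPart Y) : X = Y := by
  rw [← toC_rePart_add_imPart X, h1, h2, toC_rePart_add_imPart]

/-! ### The channel and the virtual scattering matrix through the resolvent. -/

namespace Network

variable {NT NI NR : ℕ} (net : Network NT NI NR)

/-- `barYII` is the Schur complement in the RIS and receiver blocks of `Y` with the load added; the
load is a positive semidefinite diagonal and preserves positivity of the real part. -/
lemma load_schur : (net.YRR + net.loadY).det ≠ 0 ∧ net.barYII.IsSymm ∧
    (rePart net.barYII).PosDef := by
  refine schur_isSymm_and_posDef (Matrix.IsSymm.ext ?_) ?_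
  · rintro (i | i) (j | j)
    · exact net.symm.apply _ _
    · exact net.symm.apply _ _
    · exact net.symm.apply _ _
    · change net.Y _ _ + net.loadY j i = net.Y _ _ + net.loadY i j
      rw [net.symm.apply]
      congr 1
      simp only [loadY, Matrix.diagonal_apply, eq_comm (a := i)]
      split_ifs with h
      · rw [h]
      · rfl
  · have h1 : (rePart net.Y).submatrix Sum.inr Sum.inr |>.PosDef :=
      net.re_posDef.submatrix Sum.inr_injective
    have h2 : (Matrix.diagonal (Sum.elim 0 net.yR : Fin NI ⊕ Fin NR → ℝ)).PosSemidef :=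
      Matrix.PosSemidef.diagonal (by
        rintro (i | i)
        · exact le_rfl
        · exact (net.yR_pos i).le)
    have := h1.add_posSemidef h2
    convert this using 1
    ext (i | i) (j | j)
    · by_cases h : i = j <;>
        simp [rePart, YII, h]
    · simp [rePart, YIR]
    · simp [rePart, YRI]
    · by_cases h : i = j <;>
        simp [rePart, YRR, loadY, h]

/-- The square root of `Re(barYII)`. -/
noncomputable def sqrtRe : Matrix (Fin NI) (Fin NI) ℝ := CFC.sqrt (rePart net.barYII)

lemma sqrtRe_mul_sqrtRe : net.sqrtRe * net.sqrtRe = rePart net.barYII :=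
  CFC.sqrt_mul_sqrt_self _ net.load_schur.2.2.posSemidef.nonneg

lemma sqrtRe_isSymm : net.sqrtReᵀ = net.sqrtRe := by
  have : (net.sqrtRe).PosSemidef := Matrix.nonneg_iff_posSemidef.1 (CFC.sqrt_nonneg _)
  simpa using this.isHermitian.eq

lemma isUnit_det_sqrtRe : IsUnit net.sqrtRe.det := by
  have h := (Matrix.isUnit_iff_isUnit_det _).1 net.load_schur.2.2.isUnit
  rw [← sqrtRe_mul_sqrtRe, Matrix.det_mul] at h
  exact isUnit_of_mul_isUnit_left h

lemma invSqrt_mul_sqrtRe : net.invSqrt * net.sqrtRe = 1 :=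
  Matrix.nonsing_inv_mul _ net.isUnit_det_sqrtRe

lemma sqrtRe_mul_invSqrt : net.sqrtRe * net.invSqrt = 1 :=
  Matrix.mul_nonsing_inv _ net.isUnit_det_sqrtRe

lemma toC_invSqrt_mul_sqrtRe : toC net.invSqrt * toC net.sqrtRe = 1 := by
  rw [← toC_mul, invSqrt_mul_sqrtRe, toC_one]

lemma toC_sqrtRe_mul_invSqrt : toC net.sqrtRe * toC net.invSqrt = 1 := by
  rw [← toC_mul, sqrtRe_mul_invSqrt, toC_one]

/-- The matrix whose resolvent `(barYIIᴴ - iB)⁻¹` governs the exceptional set. -/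
noncomputable def adj : Matrix (Fin NI) (Fin NI) ℂ := net.barYIIᴴ

lemma adj_isSymm : net.adj.IsSymm := by
  exact congrArg Matrix.conjTranspose net.load_schur.2.1

lemma rePart_adj : rePart net.adj = rePart net.barYII := by
  ext i j
  simp [rePart, adj, net.load_schur.2.1.apply]

lemma rePart_adj_posDef : (rePart net.adj).PosDef := by
  rw [rePart_adj]
  exact net.load_schur.2.2

variable {B : Matrix (Fin NI) (Fin NI) ℝ}

lemma conjTranspose_adj_sub (hB : B.IsSymm) :
    (net.adj - Complex.I • toC B)ᴴ = Complex.I • toC B + net.barYII := by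
  have : (toC B)ᴴ = toC B := by
    ext i j
    simp [toC, hB.apply]
  rw [Matrix.conjTranspose_sub, Matrix.conjTranspose_smul, this, adj,
    Matrix.conjTranspose_conjTranspose]
  simp [add_comm]

lemma inv_add_barYII (hB : B.IsSymm) :
    (Complex.I • toC B + net.barYII)⁻¹ = (resolvent net.adj B)ᴴ := by
  rw [resolvent, Matrix.conjTranspose_nonsing_inv, conjTranspose_adj_sub net hB]

lemma resolvent_transpose (hB : B.IsSymm) :
    (resolvent net.adj B)ᵀ = resolvent net.adj B := by
  rw [resolvent, Matrix.transpose_nonsing_inv, isSymm_sub_I_smul net.adj_isSymm hB]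

lemma congr_add_barYII (B : Matrix (Fin NI) (Fin NI) ℝ) :
    toC net.invSqrt * (Complex.I • toC B + net.barYII) * toC net.invSqrt =
      1 + Complex.I • toC (net.invSqrt * (B + imPart net.barYII) * net.invSqrt) := by
  have h : Complex.I • toC B + net.barYII =
      toC net.sqrtRe * toC net.sqrtRe + Complex.I • toC (B + imPart net.barYII) := by
    rw [← toC_mul, sqrtRe_mul_sqrtRe]
    nth_rewrite 1 [← toC_rePart_add_imPart net.barYII]
    ext i j
    simp [toC]
    ring
  rw [h, Matrix.mul_add, Matrix.add_mul, toC_mul, toC_mul, Matrix.mul_smul, Matrix.smul_mul,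
    ← Matrix.mul_assoc, toC_invSqrt_mul_sqrtRe, Matrix.one_mul, toC_sqrtRe_mul_invSqrt]

/-- The virtual scattering matrix in terms of the resolvent. -/
lemma barTheta_eq (hB : B.IsSymm) : net.barTheta B =
    (2 : ℂ) • (toC net.sqrtRe * (resolvent net.adj B)ᴴ * toC net.sqrtRe) - 1 := by
  have hy : (net.y0 : ℂ) ≠ 0 := by exact_mod_cast net.y0_pos.ne'
  set Z := toC net.invSqrt * (Complex.I • toC B + net.barYII) * toC net.invSqrt with hZ
  set Z' := toC net.sqrtRe * (resolvent net.adj B)ᴴ * toC net.sqrtRe with hZ'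
  -- With `Z' = Z⁻¹`, the definition of `Θ` becomes `Z' * (2 - Z) = 2 Z' - 1`; the reference
  -- admittance cancels.
  have hinv : Z' * Z = 1 := by
    have h1 : (resolvent net.adj B)ᴴ * (Complex.I • toC B + net.barYII) = 1 := by
      rw [← conjTranspose_adj_sub net hB, ← Matrix.conjTranspose_mul,
        self_mul_resolvent net.adj_isSymm net.rePart_adj_posDef hB, Matrix.conjTranspose_one]
    calc Z' * Z = toC net.sqrtRe * ((resolvent net.adj B)ᴴ *
          ((toC net.sqrtRe * toC net.invSqrt) * (Complex.I • toC B + net.barYII))) *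
          toC net.invSqrt := by simp only [hZ, hZ', Matrix.mul_assoc]
      _ = 1 := by
        rw [toC_sqrtRe_mul_invSqrt, Matrix.one_mul, h1, Matrix.mul_one, toC_sqrtRe_mul_invSqrt]
  have hbar : Complex.I • toC (net.barB B) = (net.y0 : ℂ) • (Z - 1) := by
    rw [hZ, congr_add_barYII, add_sub_cancel_left, barB]
    ext i j
    simp [toC]
    ring
  have h1 : (net.y0 : ℂ) • (1 : Matrix (Fin NI) (Fin NI) ℂ) + Complex.I • toC (net.barB B) =
      (net.y0 : ℂ) • Z := by
    rw [hbar, ← smul_add, add_sub_cancel]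
  have h2 : (net.y0 : ℂ) • (1 : Matrix (Fin NI) (Fin NI) ℂ) - Complex.I • toC (net.barB B) =
      (net.y0 : ℂ) • ((2 : ℂ) • 1 - Z) := by
    rw [hbar, ← smul_sub, two_smul]
    congr 1
    abel
  have h3 : ((net.y0 : ℂ) • Z)⁻¹ = (net.y0 : ℂ)⁻¹ • Z' := by
    refine Matrix.inv_eq_left_inv ?_
    rw [Matrix.smul_mul, Matrix.mul_smul, smul_smul, inv_mul_cancel₀ hy, one_smul, hinv]
  rw [barTheta, h1, h2, h3, Matrix.smul_mul, Matrix.mul_smul, smul_smul, inv_mul_cancel₀ hy,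
    one_smul, Matrix.mul_sub, hinv, Matrix.mul_smul, Matrix.mul_one]

lemma barTheta_transpose (hB : B.IsSymm) : (net.barTheta B)ᵀ = net.barTheta B := by
  have h : (toC net.sqrtRe)ᵀ = toC net.sqrtRe := by
    exact congrArg toC net.sqrtRe_isSymm
  have h' : ((resolvent net.adj B)ᴴ)ᵀ = (resolvent net.adj B)ᴴ :=
    congrArg Matrix.conjTranspose (net.resolvent_transpose hB)
  rw [barTheta_eq net hB, Matrix.transpose_sub, Matrix.transpose_smul, Matrix.transpose_mul,
    Matrix.transpose_mul, h, h', Matrix.transpose_one,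
    Matrix.mul_assoc]

/-- The channel in terms of the virtual quantities. -/
lemma channel_eq (hB : B.IsSymm) :
    net.channel B = net.barHRT + net.barHRI * net.barTheta B * net.barHIT := by
  have hy : (net.y0 : ℂ) ≠ 0 := by exact_mod_cast net.y0_pos.ne'
  have h2 : (Real.sqrt 2 : ℂ) * (Real.sqrt 2 : ℂ) = 2 := by
    norm_cast
    simp
  set X := (net.loadY + net.YRR)⁻¹ with hX
  set T := net.YIT - net.YIR * X * net.YRT with hT
  have hbar : Complex.I • toC B + net.YII - net.YIR * X * net.YRI =
      Complex.I • toC B + net.barYII := by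
    rw [barYII, hX, add_comm net.YRR, add_sub_assoc]
  have hRI : net.barHRI = -((Real.sqrt 2 / 2 : ℂ) • (X * net.YRI * toC net.invSqrt)) := by
    rw [barHRI, barYRI, smul_smul]
    congr 2
    field_simp
  have hIT : net.barHIT = -((Real.sqrt 2 / 2 : ℂ) • (toC net.invSqrt * T)) := by
    rw [barHIT, barYIT, smul_smul]
    congr 2
    field_simp
  -- The extra product cancels the contribution of the `-1` in `Θ`.
  have hRT : net.barHRT = -(X * net.YRT) + net.barHRI * net.barHIT := by
    have : net.barHRI * net.barHIT =
        ((1 / (2 * (net.y0 : ℂ))) * (1 / (2 * (net.y0 : ℂ)))) • (net.barYRI * net.barYIT) := by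
      rw [barHRI, barHIT, Matrix.neg_mul, Matrix.mul_neg, neg_neg, Matrix.smul_mul,
        Matrix.mul_smul, smul_smul]
    rw [this, barHRT, barYRT, smul_sub, smul_smul, smul_smul, neg_sub, sub_eq_add_neg, add_comm]
    congr 2
    rw [one_div, inv_mul_cancel₀ (by simpa using hy), one_smul]
  have hmid : net.barHRI * ((2 : ℂ) • (toC net.sqrtRe * (resolvent net.adj B)ᴴ *
      toC net.sqrtRe)) * net.barHIT = X * net.YRI * (resolvent net.adj B)ᴴ * T := by
    rw [hRI, hIT]
    simp only [Matrix.neg_mul, Matrix.mul_neg, smul_neg, neg_neg, Matrix.smul_mul,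
      Matrix.mul_smul, smul_smul]
    rw [show (Real.sqrt 2 / 2 : ℂ) * (2 * (Real.sqrt 2 / 2)) = 1 by linear_combination h2 / 2,
      one_smul]
    calc _ = X * net.YRI * ((toC net.invSqrt * toC net.sqrtRe) * (resolvent net.adj B)ᴴ *
          (toC net.sqrtRe * toC net.invSqrt)) * T := by simp only [Matrix.mul_assoc]
      _ = _ := by
        rw [toC_invSqrt_mul_sqrtRe, toC_sqrtRe_mul_invSqrt, Matrix.one_mul, Matrix.mul_one]
  rw [channel, ← hX, hbar, inv_add_barYII net hB, barTheta_eq net hB, ← hT,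
    Matrix.mul_sub net.barHRI, Matrix.sub_mul (net.barHRI * _), hmid, hRT, Matrix.mul_add,
    Matrix.mul_neg, Matrix.mul_one]
  simp only [Matrix.mul_assoc]
  abel

/-! ### The link as the solution of a linear system. -/

section Link

variable {k : ℕ}

/-- The matrix `2i Re(barYII)^(1/2) Lᴴ`. -/
noncomputable def linkC (L : Matrix (Fin k) (Fin NI) ℂ) : Matrix (Fin NI) (Fin k) ℂ :=
  (2 * Complex.I) • (toC net.sqrtRe * Lᴴ)

lemma conjTranspose_sqrtRe : (toC net.sqrtRe)ᴴ = toC net.sqrtRe := by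
  ext i j
  have := congrFun (congrFun net.sqrtRe_isSymm i) j
  simp only [Matrix.transpose_apply] at this
  simp [toC, this]

/-- Adding `i Lᴴ` removes the `-1` of `Θ`, so that only the resolvent term remains. -/
lemma smul_linkU_add (L : Matrix (Fin k) (Fin NI) ℂ) (hB : B.IsSymm) :
    Complex.I • net.linkU L B + Complex.I • Lᴴ =
      toC net.sqrtRe * (resolvent net.adj B * net.linkC L) := by
  rw [linkU, barTheta_eq net hB, Matrix.mul_sub, Matrix.mul_one, Matrix.conjTranspose_sub,
    smul_sub, sub_add_cancel, Matrix.mul_smul, Matrix.conjTranspose_smul,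
    Matrix.conjTranspose_mul, Matrix.conjTranspose_mul, Matrix.conjTranspose_mul,
    Matrix.conjTranspose_conjTranspose, conjTranspose_sqrtRe, linkC, smul_smul]
  simp only [Matrix.mul_smul, Matrix.mul_assoc]
  congr 1
  simp [mul_comm]

lemma barM_linkU (L : Matrix (Fin k) (Fin NI) ℂ) (hB : B.IsSymm) :
    net.barM L (net.linkU L B) = Matrix.fromCols (rePart (resolvent net.adj B * net.linkC L))
      (imPart (resolvent net.adj B * net.linkC L)) := by
  rw [barM, smul_linkU_add net L hB, rePart_toC_mul, imPart_toC_mul, ← Matrix.mul_fromCols,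
    ← Matrix.mul_assoc, invSqrt_mul_sqrtRe, Matrix.one_mul]

/-- Configurations with the same action on the exceptional matrix have the same link. -/
lemma link_eq_of_mul_barM_eq (L : Matrix (Fin k) (Fin NI) ℂ)
    {B' : Matrix (Fin NI) (Fin NI) ℝ} (hB : B.IsSymm) (hB' : B'.IsSymm)
    (h : B' * net.barM L (net.linkU L B) = B * net.barM L (net.linkU L B)) :
    L * net.barTheta B' = L * net.barTheta B := by
  set x := resolvent net.adj B * net.linkC L with hx
  rw [barM_linkU net L hB, Matrix.mul_fromCols, Matrix.mul_fromCols, ← hx] at h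
  have h1 : toC B' * x = toC B * x := by
    apply eq_of_rePart_eq_of_imPart_eq
    · rw [rePart_toC_mul, rePart_toC_mul]
      exact congrArg Matrix.toCols₁ h
    · rw [imPart_toC_mul, imPart_toC_mul]
      exact congrArg Matrix.toCols₂ h
  -- The system `(A - iB) x = C` sees `B` only through `B x`, so the same `x` solves it for `B'`.
  have h2 : (net.adj - Complex.I • toC B') * x = net.linkC L := by
    rw [Matrix.sub_mul, Matrix.smul_mul, h1, ← Matrix.smul_mul, ← Matrix.sub_mul, hx,
      ← Matrix.mul_assoc, self_mul_resolvent net.adj_isSymm net.rePart_adj_posDef hB,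
      Matrix.one_mul]
  have h3 : x = resolvent net.adj B' * net.linkC L := by
    rw [← h2, ← Matrix.mul_assoc, resolvent_mul_self net.adj_isSymm net.rePart_adj_posDef hB',
      Matrix.one_mul]
  have h4 : Complex.I • net.linkU L B' + Complex.I • Lᴴ =
      Complex.I • net.linkU L B + Complex.I • Lᴴ := by
    rw [smul_linkU_add net L hB, smul_linkU_add net L hB', ← h3]
  have h5 := smul_right_injective _ Complex.I_ne_zero (add_right_cancel h4)
  exact Matrix.conjTranspose_injective h5

end Link

end Network

lemma IsRegular.congr {E ι : Type*} {c : E → ι → ℝ} {V : Set E} {F G : E → ℝ}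
    (hF : IsRegular c V F) (h : ∀ x ∈ V, G x = F x) : IsRegular c V G := by
  obtain ⟨p, q, hpq⟩ := hF
  exact ⟨p, q, fun x hx => by rw [h x hx]; exact hpq x hx⟩

/-! ### Generic configurations, reachable channels and reciprocity. -/

namespace Network

variable {NT NI NR : ℕ} (net : Network NT NI NR) {k : ℕ}

/-- The matrices `U` with a singular submatrix are exceptional among all complex matrices. -/
lemma isLowDimIn_singularU (L : Matrix (Fin k) (Fin NI) ℂ) :
    IsLowDimIn complexCoords Set.univ (net.singularU L) := by
  have hent : ∀ i j, IsRegularC (complexCoords (m := Fin NI) (n := Fin k)) Set.univ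
      fun U => (Complex.I • U + Complex.I • Lᴴ) i j := by
    intro i j
    have hU : IsRegularC (complexCoords (m := Fin NI) (n := Fin k)) Set.univ fun U => U i j :=
      ⟨IsRegular.coord (Sum.inl (i, j)), IsRegular.coord (Sum.inr (i, j))⟩
    exact ((IsRegularC.const Complex.I).mul hU).add (.const (Complex.I * Lᴴ i j))
  refine isLowDimIn_hasSingularSubmatrix (isIrreducibleIn_complexCoords _ _) Set.univ_nonempty
    (M := net.barM L) (fun i j => ?_) fun s e f => ?_
  · simp only [barM, Matrix.mul_apply]
    refine IsRegular.sum _ fun l _ => (IsRegular.const _).mul ?_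
    rcases j with j | j
    · exact (hent l j).1
    · exact (hent l j).2
  · classical
    -- A partial permutation matrix whose chosen submatrix is the identity. The map from `U` to the
    -- real matrix is onto, and the witness below is a preimage of `X`.
    let X : Matrix (Fin NI) (Fin k ⊕ Fin k) ℝ := fun i x => if ∃ a, e a = i ∧ f a = x then 1 else 0
    let V : Matrix (Fin NI) (Fin k) ℂ := toC net.sqrtRe *
      (toC X.toCols₁ + Complex.I • toC X.toCols₂)
    have hV : Complex.I • (-(Complex.I • V) - Lᴴ) + Complex.I • Lᴴ = V := by
      rw [smul_sub, sub_add_cancel, smul_neg, smul_smul, Complex.I_mul_I, neg_smul, one_smul,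
        neg_neg]
    have hre : rePart (toC X.toCols₁ + Complex.I • toC X.toCols₂) = X.toCols₁ := by
      ext i j
      simp [rePart, toC]
    have him : imPart (toC X.toCols₁ + Complex.I • toC X.toCols₂) = X.toCols₂ := by
      ext i j
      simp [imPart, toC]
    refine ⟨-(Complex.I • V) - Lᴴ, trivial, ?_⟩
    rw [barM, hV, rePart_toC_mul, imPart_toC_mul, ← Matrix.mul_fromCols, hre, him,
      ← Matrix.mul_assoc, invSqrt_mul_sqrtRe, Matrix.one_mul, Matrix.fromCols_toCols]
    have : X.submatrix e f = 1 := by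
      ext a b
      simp only [X, Matrix.one_apply]
      refine if_congr ⟨?_, ?_⟩ rfl rfl
      · rintro ⟨c, h1, h2⟩
        exact (e.injective h1).symm.trans (f.injective h2)
      · rintro rfl
        exact ⟨a, rfl, rfl⟩
    rw [this]
    simp

/-- Distinct real and imaginary parts of columns of `linkC L` are independent over `ℝ`. -/
lemma linkC_columns_independent {L : Matrix (Fin k) (Fin NI) ℂ} (hL : MaximalRank L) {s : ℕ}
    (hs : s ≤ NI) (f : Fin s ↪ Fin k ⊕ Fin k) {α : Fin s → ℝ}
    (h : (Matrix.fromCols (net.linkC L) (-Complex.I • net.linkC L)).submatrix id f *ᵥ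
      (fun j => (α j : ℂ)) = 0) : α = 0 := by
  classical
  set α' : Fin k ⊕ Fin k → ℝ := Function.extend f α 0 with hα'
  have hα'f : ∀ a, α' (f a) = α a := fun a => f.injective.extend_apply _ _ _
  -- A real relation among columns of `C` and `-iC` is a complex relation among columns of `C`. It
  -- involves at most `s ≤ NI` of them, which is where maximal rank applies.
  set γ : Fin k → ℂ := fun c => (α' (Sum.inl c) : ℂ) - Complex.I * α' (Sum.inr c) with hγ
  have h1 : net.linkC L *ᵥ γ = 0 := by
    rw [← h]
    funext i
    have h2 : ∀ y : Fin k ⊕ Fin k → ℂ, ∑ j, y (f j) * α j = ∑ x, y x * α' x := by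
      intro y
      rw [← Finset.sum_subset (Finset.subset_univ (Finset.univ.map f)) (fun x _ hx => ?_),
        Finset.sum_map]
      · simp [hα'f]
      · have : α' x = 0 := by
          rw [hα', Function.extend_apply']
          · rfl
          · rintro ⟨a, rfl⟩
            exact hx (Finset.mem_map_of_mem f (Finset.mem_univ a))
        simp [this]
    change ∑ c, net.linkC L i c * γ c =
      ∑ j, Matrix.fromCols (net.linkC L) (-Complex.I • net.linkC L) i (f j) * (α j : ℂ)
    rw [h2, Fintype.sum_sum_type, ← Finset.sum_add_distrib]
    refine Finset.sum_congr rfl fun c _ => ?_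
    simp [hγ]
    ring
  have h2 : Lᴴ *ᵥ γ = 0 := by
    rw [linkC, Matrix.smul_mulVec] at h1
    have h1 := (smul_eq_zero.1 h1).resolve_left (by simp)
    have := congrArg (fun v => toC net.invSqrt *ᵥ v) h1
    simpa [Matrix.mulVec_mulVec, ← Matrix.mul_assoc, toC_invSqrt_mul_sqrtRe] using this
  set S : Finset (Fin k) := Finset.univ.image fun a => Sum.elim id id (f a) with hS
  have hScard : S.card ≤ NI := (Finset.card_image_le.trans (by simp)).trans hs
  have hγS : ∀ c ∉ S, γ c = 0 := by
    intro c hc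
    have : ∀ x : Fin k ⊕ Fin k, Sum.elim id id x = c → α' x = 0 := by
      intro x hx
      rw [hα', Function.extend_apply']
      · rfl
      · rintro ⟨a, rfl⟩
        exact hc (Finset.mem_image.2 ⟨a, Finset.mem_univ a, hx⟩)
    simp [hγ, this (Sum.inl c) rfl, this (Sum.inr c) rfl]
  have hγ0 : ∀ c, γ c = 0 := by
    intro c
    by_cases hc : c ∈ S
    · have hli := Fintype.linearIndependent_iff.1 (hL S hScard) (fun c => star (γ c)) (by
        funext i
        have h3 := congrArg star (congrFun h2 i)
        simp only [Matrix.mulVec, dotProduct, Matrix.conjTranspose_apply, star_sum, star_mul',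
          star_star, Pi.zero_apply, star_zero] at h3
        rw [← Finset.sum_subset (Finset.subset_univ S) fun c _ hc => by simp [hγS c hc],
          ← Finset.sum_coe_sort] at h3
        rw [Finset.sum_apply]
        simpa [mul_comm] using h3) ⟨c, hc⟩
      simpa using hli
    · exact hγS c hc
  funext a
  rw [← hα'f a]
  rcases f a with c | c
  · simpa [hγ] using congrArg Complex.re (hγ0 c)
  · simpa [hγ] using congrArg Complex.im (hγ0 c)

/-- If `L` has maximal rank, the configurations whose link matrix has a singular submatrix are
exceptional. -/
lemma isLowDimIn_linkU_mem_singularU {L : Matrix (Fin k) (Fin NI) ℂ} (hL : MaximalRank L) :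
    IsLowDimIn realCoords (fullySet NI) {B | net.linkU L B ∈ net.singularU L} := by
  have hA := net.adj_isSymm
  have hR := net.rePart_adj_posDef
  refine isLowDimIn_hasSingularSubmatrix (isIrreducibleIn_fullySet NI) (fullySet_nonempty NI)
    (M := fun B => net.barM L (net.linkU L B)) (fun i j => ?_) fun s e f => ?_
  · rcases j with j | j
    · exact (isRegularC_resolvent_mul hA hR (net.linkC L) i j).1.congr fun B hB => by
        rw [barM_linkU net L hB]; rfl
    · exact (isRegularC_resolvent_mul hA hR (net.linkC L) i j).2.congr fun B hB => by
        rw [barM_linkU net L hB]; rfl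
  -- As `Im w = Re(-i w)`, every minor of `[Re x, Im x]` is a minor of a real part, with columns
  -- taken from `C` and `-iC`.
  · obtain ⟨B, hB, hdet⟩ := exists_det_rePart_resolvent_mul_ne_zero hA hR e
      ((Matrix.fromCols (net.linkC L) (-Complex.I • net.linkC L)).submatrix id f)
      fun α hα => net.linkC_columns_independent hL
        (by simpa using Fintype.card_le_of_embedding e) f hα
    refine ⟨B, hB, ?_⟩
    convert hdet using 2
    rw [barM_linkU net L hB]
    ext a b
    have hcol : (resolvent net.adj B *
        (Matrix.fromCols (net.linkC L) (-Complex.I • net.linkC L)).submatrix id f) (e a) b =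
        (resolvent net.adj B * Matrix.fromCols (net.linkC L) (-Complex.I • net.linkC L))
          (e a) (f b) := rfl
    rw [Matrix.map_apply, Matrix.submatrix_apply, Matrix.submatrix_apply, id, hcol,
      Matrix.mul_fromCols]
    rcases f b with c | c
    · rfl
    · simp [imPart]

/-- The architecture `𝓑` attains every non-exceptional link with `k` rows. -/
def AttainsLinks (k : ℕ) (𝓑 : Set (Matrix (Fin NI) (Fin NI) ℝ)) : Prop :=
  ∀ (L : Matrix (Fin k) (Fin NI) ℂ) (B : Matrix (Fin NI) (Fin NI) ℝ), B.IsSymm →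
    net.linkU L B ∉ net.singularU L → ∃ B' ∈ 𝓑, L * net.barTheta B' = L * net.barTheta B

lemma attainsLinks_bandSet {q : ℕ} (hk : 1 ≤ k) (hq : NI ≤ q + 1 ∨ 2 * k ≤ q + 1) :
    net.AttainsLinks k (bandSet NI q) := by
  intro L B hB hU
  obtain ⟨B', hB', h⟩ := exists_mem_bandSet (q := q) (M := net.barM L (net.linkU L B))
    (hq.imp_right fun h => ⟨rowsInGeneralPosition_of_not_hasSingularSubmatrix hU, by
      simp; omega⟩) (by simp; omega) hB
  exact ⟨B', hB', net.link_eq_of_mul_barM_eq L hB hB'.1 h⟩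

lemma attainsLinks_graphSet {G : SimpleGraph (Fin NI)} (hG : G.Connected) :
    net.AttainsLinks 1 (graphSet G) := by
  intro L B hB hU
  obtain ⟨B', hB', h⟩ := (rowsInGeneralPosition_of_not_hasSingularSubmatrix hU).exists_mem_graphSet
    (by simp) hG hB
  exact ⟨B', hB', net.link_eq_of_mul_barM_eq L hB hB'.1 h⟩

variable {𝓑 : Set (Matrix (Fin NI) (Fin NI) ℝ)}

/-- Outside an exceptional set of configurations the link is attained, even if `L` is rank
deficient. -/
lemma AttainsLinks.isLowDimIn (h : net.AttainsLinks k 𝓑) (hk : k ≤ NI)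
    (L : Matrix (Fin k) (Fin NI) ℂ) :
    IsLowDimIn realCoords (fullySet NI)
      {B | ¬ ∃ B' ∈ 𝓑, L * net.barTheta B' = L * net.barTheta B} := by
  -- Attaining the link of `L'` attains that of `F * L'`, so the full-rank case suffices.
  obtain ⟨F, L', hL', rfl⟩ := exists_eq_mul_linearIndependent_rows hk L
  refine (net.isLowDimIn_linkU_mem_singularU (L := L') fun s _ =>
    hL'.comp _ Subtype.val_injective).mono fun B hB hne => ?_
  by_contra hU
  obtain ⟨B', hB', h'⟩ := h L' B hB hU
  exact hne ⟨B', hB', by rw [Matrix.mul_assoc, Matrix.mul_assoc, h']⟩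

lemma channel_eq_of_barHRI_mul {B B' : Matrix (Fin NI) (Fin NI) ℝ} (hB : B.IsSymm)
    (hB' : B'.IsSymm) (h : net.barHRI * net.barTheta B' = net.barHRI * net.barTheta B) :
    net.channel B' = net.channel B := by
  rw [channel_eq net hB, channel_eq net hB', h]

/-- Reciprocity: `Θ` is symmetric, so the transposed link is `Θ * barHIT`. -/
lemma channel_eq_of_barHIT_mul {B B' : Matrix (Fin NI) (Fin NI) ℝ} (hB : B.IsSymm)
    (hB' : B'.IsSymm) (h : net.barHITᵀ * net.barTheta B' = net.barHITᵀ * net.barTheta B) :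
    net.channel B' = net.channel B := by
  have := congrArg Matrix.transpose h
  rw [Matrix.transpose_mul, Matrix.transpose_mul, Matrix.transpose_transpose,
    barTheta_transpose net hB, barTheta_transpose net hB'] at this
  rw [channel_eq net hB, channel_eq net hB', Matrix.mul_assoc, Matrix.mul_assoc, this]

lemma channel_eq_linkU_barHRI {B : Matrix (Fin NI) (Fin NI) ℝ} (hB : B.IsSymm) :
    net.channel B = net.barHRT + (net.linkU net.barHRI B)ᴴ * net.barHIT := by
  rw [channel_eq net hB, linkU, Matrix.conjTranspose_conjTranspose]

lemma channel_eq_linkU_barHIT {B : Matrix (Fin NI) (Fin NI) ℝ} (hB : B.IsSymm) :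
    net.channel B =
      (net.barHRTᵀ + (net.linkU net.barHITᵀ B)ᴴ * net.barHRIᵀ)ᵀ := by
  rw [channel_eq net hB, linkU, Matrix.conjTranspose_conjTranspose, Matrix.transpose_add,
    Matrix.transpose_mul, Matrix.transpose_mul, barTheta_transpose net hB,
    Matrix.transpose_transpose, Matrix.transpose_transpose, Matrix.transpose_transpose,
    Matrix.mul_assoc]

/-- If the channel is determined by the link `L Θ`, an architecture that attains all non-exceptional
links reaches all channels but the exceptional ones. -/
lemma reachable_eq_union {L : Matrix (Fin k) (Fin NI) ℂ} (h𝓑 : 𝓑 ⊆ fullySet NI)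
    (h : net.AttainsLinks k 𝓑)
    (hch : ∀ B B' : Matrix (Fin NI) (Fin NI) ℝ, B.IsSymm → B'.IsSymm →
      L * net.barTheta B' = L * net.barTheta B → net.channel B' = net.channel B)
    {φ : Matrix (Fin NI) (Fin k) ℂ → Matrix (Fin NR) (Fin NT) ℂ}
    (hφ : ∀ B : Matrix (Fin NI) (Fin NI) ℝ, B.IsSymm → net.channel B = φ (net.linkU L B)) :
    net.reachable (fullySet NI) =
      net.reachable 𝓑 ∪ φ '' (net.fullyU L ∩ net.singularU L) := by
  ext H
  constructor
  · rintro ⟨B, hB, rfl⟩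
    by_cases hU : net.linkU L B ∈ net.singularU L
    · exact Or.inr ⟨_, ⟨⟨B, hB, rfl⟩, hU⟩, (hφ B hB).symm⟩
    · obtain ⟨B', hB', h'⟩ := h L B hB hU
      exact Or.inl ⟨B', hB', hch B B' hB (h𝓑 hB') h'⟩
  · rintro (⟨B, hB, rfl⟩ | ⟨_, ⟨⟨B, hB, rfl⟩, -⟩, rfl⟩)
    · exact ⟨B, h𝓑 hB, rfl⟩
    · exact ⟨B, hB, hφ B hB⟩

lemma isLowDimIn_channel_not_mem {L : Matrix (Fin k) (Fin NI) ℂ} (h𝓑 : 𝓑 ⊆ fullySet NI)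
    (h : net.AttainsLinks k 𝓑) (hk : k ≤ NI)
    (hch : ∀ B B' : Matrix (Fin NI) (Fin NI) ℝ, B.IsSymm → B'.IsSymm →
      L * net.barTheta B' = L * net.barTheta B → net.channel B' = net.channel B) :
    IsLowDimIn realCoords (fullySet NI) {B | net.channel B ∉ net.reachable 𝓑} :=
  (h.isLowDimIn net hk L).mono fun B hB hne ⟨B', hB', h'⟩ =>
    hne ⟨B', hB', hch B B' hB (h𝓑 hB') h'⟩

lemma isLowDimIn_channel_not_mem_band {q : ℕ} (hNR : 1 ≤ NR) (hNT : 1 ≤ NT)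
    (hq : q + 1 = min (2 * min NR NT) NI) :
    IsLowDimIn realCoords (fullySet NI)
      {B | net.channel B ∉ net.reachable (bandSet NI q)} := by
  have hsub : bandSet NI q ⊆ fullySet NI := fun B hB => hB.1
  by_cases hN : NI ≤ q + 1
  · refine (IsLowDimIn.empty (fullySet_nonempty NI)).mono fun B hB hne => hne ⟨B, ⟨hB, ?_⟩, rfl⟩
    intro i j hij
    rw [lt_abs] at hij
    omega
  · rcases le_total NR NT with h | h
    · rw [min_eq_left h] at hq
      exact net.isLowDimIn_channel_not_mem hsub
        (net.attainsLinks_bandSet hNR (Or.inr (by omega))) (by omega)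
        fun B B' => net.channel_eq_of_barHRI_mul
    · rw [min_eq_right h] at hq
      exact net.isLowDimIn_channel_not_mem hsub
        (net.attainsLinks_bandSet hNT (Or.inr (by omega))) (by omega)
        fun B B' => net.channel_eq_of_barHIT_mul

end Network

/-- The form over `ℕ` avoids the halving and the subtraction. Its left side is positive, so all
three antenna and element counts are positive. -/
lemma succ_eq_min_of_cast {NT NI NR q : ℕ}
    (hq : (q : ℝ) = 2 * min (min (NR : ℝ) (NT : ℝ)) ((NI : ℝ) / 2) - 1) :
    q + 1 = min (2 * min NR NT) NI := by
  have h : ((q + 1 : ℕ) : ℝ) = ((min (2 * min NR NT) NI : ℕ) : ℝ) := by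
    push_cast
    rw [hq, sub_add_cancel, mul_min_of_nonneg _ _ zero_le_two, mul_div_cancel₀ _ two_ne_zero]
  exact_mod_cast h

end RIS

theorem proposition2 {NT NI NR : ℕ} (net : RIS.Network NT NI NR) (q : ℕ)
    (hq : (q : ℝ) = 2 * min (min (NR : ℝ) (NT : ℝ)) ((NI : ℝ) / 2) - 1) :
    -- the set equality, with the exceptional set built from the side with fewer antennas
    (NR ≤ NT → net.reachable (RIS.fullySet NI) =
      net.reachable (RIS.bandSet NI q) ∪ net.exceptionalR) ∧
    (NT ≤ NR → net.reachable (RIS.fullySet NI) =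
      net.reachable (RIS.bandSet NI q) ∪ net.exceptionalT) ∧
    -- the exceptional `U` are low-dimensional in the space of all complex matrices
    RIS.IsLowDimIn RIS.complexCoords Set.univ (net.singularU net.barHRI) ∧
    RIS.IsLowDimIn RIS.complexCoords Set.univ (net.singularU net.barHIT.transpose) ∧
    -- and among the configurations of the fully-connected RIS
    (RIS.MaximalRank net.barHRI →
      RIS.IsLowDimIn RIS.realCoords (RIS.fullySet NI)
        {B | net.linkU net.barHRI B ∈ net.singularU net.barHRI}) ∧
    (RIS.MaximalRank net.barHIT.transpose →
      RIS.IsLowDimIn RIS.realCoords (RIS.fullySet NI)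
        {B | net.linkU net.barHIT.transpose B ∈ net.singularU net.barHIT.transpose}) ∧
    -- only a low-dimensional set of configurations gives channels out of reach of the band
    RIS.IsLowDimIn RIS.realCoords (RIS.fullySet NI)
      {B | net.channel B ∉ net.reachable (RIS.bandSet NI q)} ∧
    -- MISO: every tree-connected RIS
    (NR = 1 → ∀ G : SimpleGraph (Fin NI), G.IsTree →
      net.reachable (RIS.fullySet NI) = net.reachable (RIS.graphSet G) ∪ net.exceptionalR ∧
      RIS.IsLowDimIn RIS.realCoords (RIS.fullySet NI)
        {B | net.channel B ∉ net.reachable (RIS.graphSet G)}) := by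
  have hq' := RIS.succ_eq_min_of_cast hq
  have hNR : 1 ≤ NR := by omega
  have hNT : 1 ≤ NT := by omega
  have hband : RIS.bandSet NI q ⊆ RIS.fullySet NI := fun B hB => hB.1
  refine ⟨fun h => ?_, fun h => ?_, net.isLowDimIn_singularU _, net.isLowDimIn_singularU _,
    net.isLowDimIn_linkU_mem_singularU, net.isLowDimIn_linkU_mem_singularU,
    net.isLowDimIn_channel_not_mem_band hNR hNT hq', ?_⟩
  · exact net.reachable_eq_union hband (net.attainsLinks_bandSet hNR (by omega))
      (fun B B' => net.channel_eq_of_barHRI_mul) fun B => net.channel_eq_linkU_barHRI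
  · exact net.reachable_eq_union hband (net.attainsLinks_bandSet hNT (by omega))
      (fun B B' => net.channel_eq_of_barHIT_mul) fun B => net.channel_eq_linkU_barHIT
  · rintro rfl G hG
    have hgraph : RIS.graphSet G ⊆ RIS.fullySet NI := fun B hB => hB.1
    have hlinks := net.attainsLinks_graphSet hG.connected
    exact ⟨net.reachable_eq_union hgraph hlinks (fun B B' => net.channel_eq_of_barHRI_mul)
        fun B => net.channel_eq_linkU_barHRI,
      net.isLowDimIn_channel_not_mem hgraph hlinks (by omega)
        fun B B' => net.channel_eq_of_barHRI_mul⟩
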